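/- **Theorem 3.2.** Let $0<2\alpha<1$ and $0<2\beta<1$. Put $$q_1(x,y;x_0,y_0)=k_1\,(r^2)^{-\alpha-\beta}\,F_2\left(\alpha+\beta;\alpha,\beta;2\alpha,2\beta;\xi,\eta\right),\qquad k_1=\frac{2^{2\alpha+2\beta}}{4\pi}\,\frac{\Gamma(\alpha)\Gamma(\beta)\Gamma(\alpha+\beta)}{\Gamma(2\alpha)\Gamma(2\beta)},$$ where $r^2=(x-x_0)^2+(y-y_0)^2$, $r_1^2=(x+x_0)^2+(y-y_0)^2$, $r_2^2=(x-x_0)^2+(y+y_0)^2$, $\xi=(r^2-r_1^2)/r^2$, $\eta=(r^2-r_2^2)/r^2$, and $F_2$ is Appell's hypergeometric function $$F_2(a;b_1,b_2;c_1,c_2;\xi,\eta)=\sum_{m,n\ge 0}\frac{(a)_{m+n}(b_1)_m(b_2)_n}{(c_1)_m(c_2)_n\,m!\,n!}\,\xi^m\eta^n\qquad(|\xi|+|\eta|<1),$$ continued analytically to $\xi\le 0$, $\eta\le 0$ by Euler's double integral. Let $a,b,l>0$ and let $\Gamma$ be a simple curve of length $l$ from $A=(a,0)$ to $B=(0,b)$,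 parametrized by arc length as $(x(s),y(s))$, $0\le s\le l$, starting at $A$, with $x(s)>0$ and $y(s)>0$ for $0<s<l$, such that $x(s)$, $y(s)$ are twice continuously differentiable on $[0,l]$ and $x''$, $y''$ are Hölder continuous on $[0,l]$. Assume that there are constants $c$ and $0<\varepsilon<1$ such that, in neighborhoods of the endpoints $A$ and $B$, $$\left|\frac{dx}{ds}\right|\le c\,y(s)^{1+\varepsilon},\qquad \left|\frac{dy}{ds}\right|\le c\,x(s)^{1+\varepsilon}.\tag{3.1}$$ Let $\frac{\partial}{\partial n}=\frac{dy}{ds}\frac{\partial}{\partial x}-\frac{dx}{ds}\frac{\partial}{\partial y}$ be the normal derivative on $\Gamma$ in the variables $(x,y)$. Then there is a constant $C_1$, depending only on $\alpha$, $\beta$ and $\Gamma$, such that for all $(x_0,y_0)$ with $x_0\ge 0$ and $y_0\ge 0$ the integral below converges and $$\int_\Gamma x^{2\alpha}y^{2\beta}\left|\frac{\partial q_1(x,y;x_0,y_0)}{\partial n}\right|ds\le C_1 .$$ -/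

import Mathlib

open MeasureTheory Set

/-- Appell's function `F₂(a; b₁, b₂; c₁, c₂; x, y)` for `0 < b₁ < c₁`, `0 < b₂ < c₂` and
`x < 1`, `y < 1`, `x + y < 1`, through Euler's double integral. On `|x| + |y| < 1` this is the sum
of the hypergeometric double series
`∑ (a)_{m+n} (b₁)_m (b₂)_n / ((c₁)_m (c₂)_n m! n!) x ^ m y ^ n`
(see `hasSum_appellF2`), and on the rest of the region it is the analytic continuation of that
series; in particular it is the continuation to the whole quadrant `x ≤ 0`, `y ≤ 0`. -/
noncomputable def appellF2 (a b₁ b₂ c₁ c₂ x y : ℝ) : ℝ :=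
  Real.Gamma c₁ / (Real.Gamma b₁ * Real.Gamma (c₁ - b₁)) *
    (Real.Gamma c₂ / (Real.Gamma b₂ * Real.Gamma (c₂ - b₂))) *
    ∫ p in Ioo (0 : ℝ) 1 ×ˢ Ioo (0 : ℝ) 1,
      (p.1 ^ (b₁ - 1) * (1 - p.1) ^ (c₁ - b₁ - 1)) *
      (p.2 ^ (b₂ - 1) * (1 - p.2) ^ (c₂ - b₂ - 1)) *
      (1 - p.1 * x - p.2 * y) ^ (-a)

theorem appellF2_aux_binomial (a t : ℝ) (ht : |t| < 1) :
    HasSum (fun k : ℕ => (ascPochhammer ℝ k).eval a / k.factorial * t ^ k)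
      ((1 - t) ^ (-a)) := by
  have h := (Real.one_div_one_sub_rpow_hasFPowerSeriesOnBall_zero a).hasSum (y := t)
    (by simpa [enorm_eq_nnnorm, ← NNReal.coe_lt_coe] using ht)
  have h1 : 0 ≤ 1 - t := by linarith [(abs_lt.1 ht).2]
  simp only [zero_add, one_div, ← Real.rpow_neg h1] at h
  have e : (fun k : ℕ => (ascPochhammer ℝ k).eval a / k.factorial * t ^ k) =
      fun k => FormalMultilinearSeries.ofScalars ℝ (fun n : ℕ => Ring.choose (a + n - 1) n) k
        fun _ => t := by
    funext k
    have h2 := Ring.factorial_nsmul_multichoose_eq_ascPochhammer a k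
    rw [Polynomial.ascPochhammer_smeval_eq_eval, nsmul_eq_mul] at h2
    simp [← Ring.multichoose_eq, ← h2]
    field_simp
  rw [e]
  exact h

theorem appellF2_aux_beta (b c : ℝ) (hb : 0 < b) (hc : 0 < c) :
    IntegrableOn (fun u : ℝ => u ^ (b - 1) * (1 - u) ^ (c - 1)) (Ioo 0 1) ∧
    ∫ u in Ioo (0:ℝ) 1, u ^ (b - 1) * (1 - u) ^ (c - 1)
      = Real.Gamma b * Real.Gamma c / Real.Gamma (b + c) := by
  have h := Complex.betaIntegral_convergent (u := b) (v := c) (by simpa) (by simpa)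
  rw [intervalIntegrable_iff_integrableOn_Ioo_of_le (by simp)] at h
  have e : EqOn (fun x : ℝ => RCLike.re ((x : ℂ) ^ ((b:ℂ) - 1) * (1 - (x:ℂ)) ^ ((c:ℂ) - 1)))
      (fun u : ℝ => u ^ (b - 1) * (1 - u) ^ (c - 1)) (Ioo 0 1) := by
    intro x hx
    have h1 := hx.1
    have h2 := hx.2
    have : (x : ℂ) ^ ((b:ℂ) - 1) * (1 - (x:ℂ)) ^ ((c:ℂ) - 1)
        = ((x ^ (b - 1) * (1 - x) ^ (c - 1) : ℝ) : ℂ) := by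
      push_cast
      rw [Complex.ofReal_cpow h1.le, Complex.ofReal_cpow (by linarith)]
      push_cast
      rfl
    simp only [this]
    simp
  refine ⟨(integrableOn_congr_fun e measurableSet_Ioo).1 h.re, ?_⟩
  rw [← setIntegral_congr_fun measurableSet_Ioo e]
  have := ProbabilityTheory.beta_eq_betaIntegralReal b c hb hc
  rw [ProbabilityTheory.beta] at this
  rw [this, Complex.betaIntegral, intervalIntegral.integral_of_le (by norm_num),
      integral_Ioc_eq_integral_Ioo, ← RCLike.re_to_complex, ← integral_re h]

theorem appellF2_aux_gamma (b : ℝ) (hb : 0 < b) (m : ℕ) :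
    Real.Gamma (b + m) = (ascPochhammer ℝ m).eval b * Real.Gamma b := by
  induction m with
  | zero => simp
  | succ m ih =>
    rw [ascPochhammer_succ_eval, Nat.cast_succ, ← add_assoc, Real.Gamma_add_one (by positivity), ih]
    ring

theorem appellF2_aux_double (a s t : ℝ) (ha : 0 < a) (hst : |s| + |t| < 1) :
    Summable (fun q : ℕ × ℕ => (ascPochhammer ℝ (q.1 + q.2)).eval a /
      (q.1.factorial * q.2.factorial) * (|s| ^ q.1 * |t| ^ q.2)) ∧
    HasSum (fun q : ℕ × ℕ => (ascPochhammer ℝ (q.1 + q.2)).eval a /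
      (q.1.factorial * q.2.factorial) * (s ^ q.1 * t ^ q.2)) ((1 - s - t) ^ (-a)) := by
  have key : ∀ (s t : ℝ) (k : ℕ), ∑ q ∈ Finset.HasAntidiagonal.antidiagonal k,
      (ascPochhammer ℝ (q.1 + q.2)).eval a /
      (q.1.factorial * q.2.factorial) * (s ^ q.1 * t ^ q.2) =
      (ascPochhammer ℝ k).eval a / k.factorial * (s + t) ^ k := by
    intro s t k
    rw [(Commute.all s t).add_pow', Finset.mul_sum]
    refine Finset.sum_congr rfl fun q hq => ?_
    rw [Finset.HasAntidiagonal.mem_antidiagonal] at hq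
    subst hq
    have h2 := Nat.add_choose_mul_factorial_mul_factorial q.1 q.2
    rw [← Nat.choose_symm_add] at h2
    have h3 : ((q.1 + q.2).choose q.1 : ℝ) * q.1.factorial * q.2.factorial =
        (q.1 + q.2).factorial := by exact_mod_cast h2
    rw [nsmul_eq_mul, ← h3]
    have : ((q.1 + q.2).choose q.1 : ℝ) ≠ 0 := by
      have := Nat.choose_pos (Nat.le_add_right q.1 q.2)
      positivity
    field_simp
  have hsum : Summable (fun q : ℕ × ℕ => (ascPochhammer ℝ (q.1 + q.2)).eval a /
      (q.1.factorial * q.2.factorial) * (|s| ^ q.1 * |t| ^ q.2)) := by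
    rw [← Finset.HasAntidiagonal.sigmaAntidiagonalEquivProd.summable_iff, summable_sigma_of_nonneg]
    · refine ⟨fun _ => Summable.of_finite, ?_⟩
      have h := (appellF2_aux_binomial a (|s| + |t|)
        (by rwa [abs_of_nonneg (by positivity)])).summable
      refine h.congr fun k => ?_
      rw [tsum_fintype, ← key, ← Finset.sum_coe_sort]
      rfl
    · intro q
      have := ascPochhammer_pos (q.2.1.1 + q.2.1.2) a ha
      simp only [Function.comp, Finset.HasAntidiagonal.sigmaAntidiagonalEquivProd_apply]
      positivity
  refine ⟨hsum, ?_⟩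
  have hs2 : Summable (fun q : ℕ × ℕ => (ascPochhammer ℝ (q.1 + q.2)).eval a /
      (q.1.factorial * q.2.factorial) * (s ^ q.1 * t ^ q.2)) := by
    refine Summable.of_norm (hsum.congr fun q => ?_)
    have := ascPochhammer_pos (q.1 + q.2) a ha
    simp only [norm_mul, norm_div, norm_pow, Real.norm_eq_abs, abs_of_pos this, Nat.abs_cast]
  have h3 := Finset.HasAntidiagonal.sigmaAntidiagonalEquivProd.summable_iff.2 hs2
  have h4 := Finset.HasAntidiagonal.sigmaAntidiagonalEquivProd.hasSum_iff.1 h3.hasSum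
  convert h4 using 1
  have h5 := h3.hasSum.sigma (fun k => (hasSum_fintype _))
  refine HasSum.unique ?_ h5
  convert appellF2_aux_binomial a (s + t) (lt_of_le_of_lt (abs_add_le _ _) hst) using 1
  · funext k
    rw [← key]
    simp only [Function.comp, Finset.HasAntidiagonal.sigmaAntidiagonalEquivProd_apply]
    exact Finset.sum_coe_sort (Finset.HasAntidiagonal.antidiagonal k)
      fun q : ℕ × ℕ => (ascPochhammer ℝ (q.1 + q.2)).eval a /
      (q.1.factorial * q.2.factorial) * (s ^ q.1 * t ^ q.2)
  · ring_nf

/-- For `|x| + |y| < 1`, `appellF2` is the sum of Appell's double hypergeometric series. -/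
theorem hasSum_appellF2 (a b₁ b₂ c₁ c₂ x y : ℝ) (ha : 0 < a) (hb₁ : 0 < b₁) (hc₁ : b₁ < c₁)
    (hb₂ : 0 < b₂) (hc₂ : b₂ < c₂) (hxy : |x| + |y| < 1) :
    HasSum (fun q : ℕ × ℕ => (ascPochhammer ℝ (q.1 + q.2)).eval a *
        (ascPochhammer ℝ q.1).eval b₁ * (ascPochhammer ℝ q.2).eval b₂ /
        ((ascPochhammer ℝ q.1).eval c₁ * (ascPochhammer ℝ q.2).eval c₂ *
          q.1.factorial * q.2.factorial) * x ^ q.1 * y ^ q.2)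
      (appellF2 a b₁ b₂ c₁ c₂ x y) := by
  set w : ℝ × ℝ → ℝ := fun p => (p.1 ^ (b₁ - 1) * (1 - p.1) ^ (c₁ - b₁ - 1)) *
      (p.2 ^ (b₂ - 1) * (1 - p.2) ^ (c₂ - b₂ - 1)) with hw
  have hsq : MeasurableSet (Ioo (0 : ℝ) 1 ×ˢ Ioo (0 : ℝ) 1) := measurableSet_Ioo.prod measurableSet_Ioo
  have hwm : Measurable w := by fun_prop
  have hwi : IntegrableOn w (Ioo (0 : ℝ) 1 ×ˢ Ioo (0 : ℝ) 1) := by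
    rw [IntegrableOn, Measure.volume_eq_prod, ← Measure.prod_restrict]
    exact (appellF2_aux_beta b₁ (c₁ - b₁) hb₁ (by linarith)).1.mul_prod
      (appellF2_aux_beta b₂ (c₂ - b₂) hb₂ (by linarith)).1
  have hbd : ∀ p ∈ Ioo (0 : ℝ) 1 ×ˢ Ioo (0 : ℝ) 1, |p.1 * x| ≤ |x| ∧ |p.2 * y| ≤ |y| := by
    rintro p ⟨⟨h1, h2⟩, h3, h4⟩
    rw [abs_mul, abs_mul, abs_of_pos h1, abs_of_pos h3]
    exact ⟨mul_le_of_le_one_left (abs_nonneg _) h2.le, mul_le_of_le_one_left (abs_nonneg _) h4.le⟩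
  have main := hasSum_integral_of_dominated_convergence
    (μ := volume.restrict (Ioo (0 : ℝ) 1 ×ˢ Ioo (0 : ℝ) 1))
    (F := fun (q : ℕ × ℕ) p => w p * ((ascPochhammer ℝ (q.1 + q.2)).eval a /
      (q.1.factorial * q.2.factorial) * ((p.1 * x) ^ q.1 * (p.2 * y) ^ q.2)))
    (f := fun p => w p * (1 - p.1 * x - p.2 * y) ^ (-a))
    (fun (q : ℕ × ℕ) p => |w p| * ((ascPochhammer ℝ (q.1 + q.2)).eval a /
      (q.1.factorial * q.2.factorial) * (|x| ^ q.1 * |y| ^ q.2)))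
    (fun q => Measurable.aestronglyMeasurable (by fun_prop))
    (fun q => by
      refine (ae_restrict_iff' hsq).2 (Filter.Eventually.of_forall fun p hp => ?_)
      have := ascPochhammer_pos (q.1 + q.2) a ha
      have hp := hbd p hp
      simp only [norm_mul, norm_div, norm_pow, Real.norm_eq_abs, abs_of_pos this, Nat.abs_cast]
      rw [← abs_mul p.1, ← abs_mul p.2]
      have h1 := pow_le_pow_left₀ (abs_nonneg _) hp.1 q.1
      have h2 := pow_le_pow_left₀ (abs_nonneg _) hp.2 q.2
      have h3 := mul_le_mul h1 h2 (by positivity) (by positivity)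
      exact mul_le_mul_of_nonneg_left (mul_le_mul_of_nonneg_left h3 (by positivity)) (abs_nonneg _))
    (Filter.Eventually.of_forall fun p => (appellF2_aux_double a x y ha hxy).1.mul_left _)
    (by
      simp only [tsum_mul_left]
      exact hwi.abs.mul_const _)
    (by
      refine (ae_restrict_iff' hsq).2 (Filter.Eventually.of_forall fun p hp => ?_)
      have hp := hbd p hp
      exact (appellF2_aux_double a _ _ ha (by linarith [hp.1, hp.2])).2.mul_left _)
  have main2 := main.mul_left (Real.Gamma c₁ / (Real.Gamma b₁ * Real.Gamma (c₁ - b₁)) *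
    (Real.Gamma c₂ / (Real.Gamma b₂ * Real.Gamma (c₂ - b₂))))
  have one : ∀ (b c : ℝ) (hb : 0 < b) (hc : b < c) (m : ℕ),
      ∫ u in Ioo (0:ℝ) 1, (u ^ (b - 1) * (1 - u) ^ (c - b - 1)) * u ^ m =
      (ascPochhammer ℝ m).eval b * Real.Gamma b * Real.Gamma (c - b) /
        ((ascPochhammer ℝ m).eval c * Real.Gamma c) := by
    intro b c hb hc m
    have h := (appellF2_aux_beta (b + m) (c - b) (by positivity) (by linarith)).2
    rw [appellF2_aux_gamma b hb, show b + m + (c - b) = c + m by ring,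
      appellF2_aux_gamma c (hb.trans hc)] at h
    rw [← h]
    refine setIntegral_congr_fun measurableSet_Ioo fun u hu => ?_
    rw [show b + m - 1 = b - 1 + m by ring, Real.rpow_add hu.1, Real.rpow_natCast]
    ring
  refine (congrArg (fun g => HasSum g _) (funext fun q => ?_)).mpr main2
  have e : ∀ p : ℝ × ℝ, w p * ((ascPochhammer ℝ (q.1 + q.2)).eval a /
      (q.1.factorial * q.2.factorial) * ((p.1 * x) ^ q.1 * (p.2 * y) ^ q.2)) =
      ((ascPochhammer ℝ (q.1 + q.2)).eval a / (q.1.factorial * q.2.factorial) * (x ^ q.1 * y ^ q.2)) *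
      (((p.1 ^ (b₁ - 1) * (1 - p.1) ^ (c₁ - b₁ - 1)) * p.1 ^ q.1) *
      ((p.2 ^ (b₂ - 1) * (1 - p.2) ^ (c₂ - b₂ - 1)) * p.2 ^ q.2)) := by
    intro p
    simp only [hw, mul_pow]
    ring
  simp only [e]
  rw [integral_const_mul, Measure.volume_eq_prod, setIntegral_prod_mul
    (fun u : ℝ => (u ^ (b₁ - 1) * (1 - u) ^ (c₁ - b₁ - 1)) * u ^ q.1)
    (fun u : ℝ => (u ^ (b₂ - 1) * (1 - u) ^ (c₂ - b₂ - 1)) * u ^ q.2), one _ _ hb₁ hc₁,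
    one _ _ hb₂ hc₂]
  have g1 := (Real.Gamma_pos_of_pos hb₁).ne'
  have g2 := (Real.Gamma_pos_of_pos hb₂).ne'
  have g3 := (Real.Gamma_pos_of_pos (hb₁.trans hc₁)).ne'
  have g4 := (Real.Gamma_pos_of_pos (hb₂.trans hc₂)).ne'
  have g5 := (Real.Gamma_pos_of_pos (sub_pos.2 hc₁)).ne'
  have g6 := (Real.Gamma_pos_of_pos (sub_pos.2 hc₂)).ne'
  have g7 := (ascPochhammer_pos q.1 c₁ (hb₁.trans hc₁)).ne'
  have g8 := (ascPochhammer_pos q.2 c₂ (hb₂.trans hc₂)).ne'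
  field_simp

/-- The constant `k₁` in the fundamental solution `q₁`. -/
noncomputable def k₁ (α β : ℝ) : ℝ :=
  2 ^ (2 * α + 2 * β) / (4 * Real.pi) *
    (Real.Gamma α * Real.Gamma β * Real.Gamma (α + β) /
      (Real.Gamma (2 * α) * Real.Gamma (2 * β)))

/-- The fundamental solution
`q₁(x, y; x₀, y₀) = k₁ (r²)^(-α-β) F₂(α + β; α, β; 2α, 2β; ξ, η)` of
`u_xx + u_yy + (2α/x) u_x + (2β/y) u_y = 0`, where `r² = (x - x₀)² + (y - y₀)²`,
`r₁² = (x + x₀)² + (y - y₀)²`, `r₂² = (x - x₀)² + (y + y₀)²`,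
`ξ = (r² - r₁²) / r²` and `η = (r² - r₂²) / r²`. -/
noncomputable def q₁ (α β x y x₀ y₀ : ℝ) : ℝ :=
  let rsq := (x - x₀) ^ 2 + (y - y₀) ^ 2
  let r₁sq := (x + x₀) ^ 2 + (y - y₀) ^ 2
  let r₂sq := (x - x₀) ^ 2 + (y + y₀) ^ 2
  k₁ α β * rsq ^ (-α - β) *
    appellF2 (α + β) α β (2 * α) (2 * β) ((rsq - r₁sq) / rsq) ((rsq - r₂sq) / rsq)

/-- `s ↦ (X s, Y s)`, `s ∈ [0, l]`, is the arc length parametrization of a simple curve in the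
quadrant `x > 0`, `y > 0` from `A = (a, 0)` to `B = (0, b)` (only the endpoints lie on the
axes), whose coordinate functions are twice continuously differentiable on `[0, l]` with Hölder
continuous second derivatives. The derivatives at the endpoints are one-sided. -/
structure IsBoundaryCurve (a b l : ℝ) (X Y : ℝ → ℝ) : Prop where
  a_pos : 0 < a
  b_pos : 0 < b
  l_pos : 0 < l
  start_eq : X 0 = a ∧ Y 0 = 0
  end_eq : X l = 0 ∧ Y l = b
  pos : ∀ s ∈ Ioo 0 l, 0 < X s ∧ 0 < Y s
  simple : InjOn (fun s => (X s, Y s)) (Icc 0 l)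
  contDiff_X : ContDiffOn ℝ 2 X (Icc 0 l)
  contDiff_Y : ContDiffOn ℝ 2 Y (Icc 0 l)
  arcLength : ∀ s ∈ Icc 0 l,
    derivWithin X (Icc 0 l) s ^ 2 + derivWithin Y (Icc 0 l) s ^ 2 = 1
  holder : ∃ C κ : NNReal, 0 < κ ∧ κ ≤ 1 ∧
    HolderOnWith C κ (iteratedDerivWithin 2 X (Icc 0 l)) (Icc 0 l) ∧
    HolderOnWith C κ (iteratedDerivWithin 2 Y (Icc 0 l)) (Icc 0 l)

/-- In neighbourhoods of both endpoints of the curve, `|dx/ds| ≤ c y ^ (1 + ε)` and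
`|dy/ds| ≤ c x ^ (1 + ε)`, with constants `c` and `0 < ε < 1`. -/
def EndpointCondition (l : ℝ) (X Y : ℝ → ℝ) : Prop :=
  ∃ c ε δ : ℝ, 0 < ε ∧ ε < 1 ∧ 0 < δ ∧ ∀ s ∈ Icc 0 l, (s ≤ δ ∨ l - δ ≤ s) →
    |derivWithin X (Icc 0 l) s| ≤ c * Y s ^ (1 + ε) ∧
    |derivWithin Y (Icc 0 l) s| ≤ c * X s ^ (1 + ε)

/-- The normal derivative `∂u/∂n = (dy/ds) ∂u/∂x - (dx/ds) ∂u/∂y` at the point `(X s, Y s)` of the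
curve. -/
noncomputable def normalDeriv (l : ℝ) (X Y : ℝ → ℝ) (u : ℝ → ℝ → ℝ) (s : ℝ) : ℝ :=
  derivWithin Y (Icc 0 l) s * deriv (fun x => u x (Y s)) (X s) -
    derivWithin X (Icc 0 l) s * deriv (fun y => u (X s) y) (Y s)

/-! Inserting Euler's integral removes the denominators in `ξ`, `η`: `q₁` is a constant times the
integral over the unit square of `betaWeight α u * betaWeight β v * R ^ (-(α + β))`, where `R = r² +
4 x x₀ u + 4 y y₀ v`. Its normal derivative has the power `-(α + β + 1)` of `R` and the factor
`∂R/∂n`, which splits into two pieces.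

The piece `2 (y' (x - x₀) - x' (y - y₀))` does not depend on `u, v`. The weight `x ^ (2α) y ^ (2β)`
reduces the remaining integral to a multiple of `1 / r²` (`rpow_mul_setIntegral_kernel_add_one_le`),
so what is left is the classical double layer kernel. If `d` is the distance from `(x₀, y₀)` to the
curve and `t₀` the parameter of a nearest point, `exists_nearest` dominates that kernel by a
constant plus a multiple of `d / (d² + (s - t₀)²)`, whose integral is at most `π` for every `d`.

The piece `4 x₀ u y' - 4 y₀ v x'` is at most `(|y'| / x + |x'| / y) R`. The endpoint condition
bounds the bracket, and the gained factor `R` lowers the exponent to `α + β`; the weighted integral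
is then `O(r ^ (-(α + β)))` (`rpow_mul_setIntegral_kernel_le`). This is integrable along the curve,
uniformly in the pole, because `r` dominates a multiple of `|s - t₀|` and `α + β < 1`. -/

/-! ### One-dimensional integrals against the Beta weight -/

/-- The exponents `α - 1` and `-α - 1` are matched so that `(u / (P + Q u)) ^ α / (α P)` is a
primitive. Integrability comes for free, since the integrand is a nonnegative derivative of a
continuous function. -/
theorem integrableOn_rpow_mul_add_mul_rpow {α P Q : ℝ} (hα : 0 < α) (hP : 0 < P) (hQ : 0 ≤ Q) :
    IntegrableOn (fun u : ℝ => u ^ (α - 1) * (P + Q * u) ^ (-α - 1)) (Ioo 0 1) ∧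
    ∫ u in Ioo (0 : ℝ) 1, u ^ (α - 1) * (P + Q * u) ^ (-α - 1) =
      (α * P)⁻¹ * (P + Q) ^ (-α) := by
  set g : ℝ → ℝ := fun u => (α * P)⁻¹ * (u ^ α * (P + Q * u) ^ (-α)) with hg
  have hpos : ∀ u ∈ Icc (0 : ℝ) 1, 0 < P + Q * u := fun u hu => by
    have := mul_nonneg hQ hu.1
    linarith
  have hcont : ContinuousOn g (Icc 0 1) := by
    refine continuousOn_const.mul (ContinuousOn.mul ?_ ?_)
    · exact continuousOn_id.rpow_const fun _ _ => Or.inr hα.le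
    · exact (by fun_prop : ContinuousOn (fun u => P + Q * u) _).rpow_const
        fun u hu => Or.inl (hpos u hu).ne'
  have hderiv : ∀ u ∈ Ioo (0 : ℝ) 1,
      HasDerivAt g (u ^ (α - 1) * (P + Q * u) ^ (-α - 1)) u := by
    intro u hu
    have hp := hpos u (Ioo_subset_Icc_self hu)
    have h1 := (hasDerivAt_id u).rpow_const (p := α) (Or.inl hu.1.ne')
    have h2 := (((hasDerivAt_id u).const_mul Q).const_add P).rpow_const (p := -α)
      (Or.inl hp.ne')
    refine ((h1.mul h2).const_mul (α * P)⁻¹).congr_deriv ?_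
    simp only [id]
    have e1 : u ^ α = u ^ (α - 1) * u := by
      rw [← Real.rpow_add_one hu.1.ne']; ring_nf
    have e2 : (P + Q * u) ^ (-α) = (P + Q * u) ^ (-α - 1) * (P + Q * u) := by
      rw [← Real.rpow_add_one hp.ne']; ring_nf
    rw [e1, e2]
    field_simp
    ring
  have hnn : ∀ u ∈ Ioo (0 : ℝ) 1, 0 ≤ u ^ (α - 1) * (P + Q * u) ^ (-α - 1) := fun u hu =>
    mul_nonneg (Real.rpow_nonneg hu.1.le _)
      (Real.rpow_nonneg (hpos u (Ioo_subset_Icc_self hu)).le _)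
  have hint := intervalIntegral.integrableOn_deriv_of_nonneg hcont hderiv hnn
  refine ⟨hint.mono_set Ioo_subset_Ioc_self, ?_⟩
  rw [← integral_Ioc_eq_integral_Ioo, ← intervalIntegral.integral_of_le zero_le_one,
    intervalIntegral.integral_eq_sub_of_hasDerivAt_of_le zero_le_one hcont hderiv
      ((intervalIntegrable_iff_integrableOn_Ioc_of_le zero_le_one).2 hint)]
  simp [hg, Real.zero_rpow hα.ne']

/-- The symmetric Beta weight `(u (1 - u)) ^ (α - 1)`. -/
noncomputable def betaWeight (α u : ℝ) : ℝ := u ^ (α - 1) * (1 - u) ^ (α - 1)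

@[fun_prop]
theorem measurable_betaWeight (α : ℝ) : Measurable (betaWeight α) := by
  unfold betaWeight
  fun_prop

theorem betaWeight_nonneg (α : ℝ) {u : ℝ} (hu : u ∈ Ioo (0 : ℝ) 1) : 0 ≤ betaWeight α u :=
  mul_nonneg (Real.rpow_nonneg hu.1.le _) (Real.rpow_nonneg (by linarith [hu.2]) _)

theorem integrableOn_betaWeight {α : ℝ} (hα : 0 < α) : IntegrableOn (betaWeight α) (Ioo 0 1) :=
  (appellF2_aux_beta α α hα hα).1

theorem integrableOn_betaWeight_mul_rpow {α : ℝ} (hα : 0 < α) :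
    IntegrableOn (fun u => betaWeight α u * u ^ (-(α / 2))) (Ioo 0 1) := by
  refine (appellF2_aux_beta (α / 2) α (by linarith) hα).1.congr_fun (fun u hu => ?_)
    measurableSet_Ioo
  have : u ^ (α / 2 - 1) = u ^ (α - 1) * u ^ (-(α / 2)) := by
    rw [← Real.rpow_add hu.1]; ring_nf
  simp only [betaWeight, this]
  ring

/-- One of `u`, `1 - u` is at least `1/2`, so its power is at most `2 ^ (1 - α)`. When `u ≥ 1/2`,
monotonicity replaces `f u` by `f (1 - u)`; the singularity at `1` is thereby reflected to `0`,
where the explicit primitive applies. -/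
theorem betaWeight_mul_le {α u : ℝ} {f : ℝ → ℝ} (hα₁ : α ≤ 1) (hf : AntitoneOn f (Ioo 0 1))
    (hf₀ : ∀ u ∈ Ioo (0 : ℝ) 1, 0 ≤ f u) (hu : u ∈ Ioo (0 : ℝ) 1) :
    betaWeight α u * f u ≤
      2 ^ (1 - α) * (u ^ (α - 1) * f u + (1 - u) ^ (α - 1) * f (1 - u)) := by
  have hu' : 1 - u ∈ Ioo (0 : ℝ) 1 := ⟨by linarith [hu.2], by linarith [hu.1]⟩
  have key : ∀ v : ℝ, 1 / 2 ≤ v → v ^ (α - 1) ≤ 2 ^ (1 - α) := fun v hv => by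
    have := Real.rpow_le_rpow_of_nonpos (by norm_num : (0 : ℝ) < 1 / 2) hv
      (by linarith : α - 1 ≤ 0)
    rwa [one_div, Real.inv_rpow zero_le_two, ← Real.rpow_neg zero_le_two, neg_sub] at this
  have h1 := Real.rpow_nonneg hu.1.le (α - 1)
  have h2 := Real.rpow_nonneg hu'.1.le (α - 1)
  have h3 := hf₀ u hu
  have h4 := hf₀ _ hu'
  have h5 : (0 : ℝ) ≤ 2 ^ (1 - α) := by positivity
  unfold betaWeight
  rcases le_total u (1 / 2) with h | h
  · calc u ^ (α - 1) * (1 - u) ^ (α - 1) * f u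
        = (1 - u) ^ (α - 1) * (u ^ (α - 1) * f u) := by ring
      _ ≤ 2 ^ (1 - α) * (u ^ (α - 1) * f u) :=
        mul_le_mul_of_nonneg_right (key _ (by linarith)) (by positivity)
      _ ≤ _ := mul_le_mul_of_nonneg_left (le_add_of_nonneg_right (by positivity)) h5
  · calc u ^ (α - 1) * (1 - u) ^ (α - 1) * f u
        = u ^ (α - 1) * ((1 - u) ^ (α - 1) * f u) := by ring
      _ ≤ 2 ^ (1 - α) * ((1 - u) ^ (α - 1) * f u) :=
        mul_le_mul_of_nonneg_right (key _ h) (by positivity)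
      _ ≤ 2 ^ (1 - α) * ((1 - u) ^ (α - 1) * f (1 - u)) :=
        mul_le_mul_of_nonneg_left (mul_le_mul_of_nonneg_left (hf hu' hu (by linarith)) h2) h5
      _ ≤ _ := mul_le_mul_of_nonneg_left (le_add_of_nonneg_left (by positivity)) h5

/-- The excess exponent `τ` is paid for by `(P + Q u) ^ (-τ) ≤ P ^ (-τ)`, and the rest is integrated
exactly. The two reflected halves contribute equally, hence `2 ^ (2 - α)`. The factor `(P + Q) ^
(-α)` is kept because it will cancel the weight `x ^ (2α)`. -/
theorem setIntegral_betaWeight_mul_rpow_le {α P Q τ : ℝ} (hα : 0 < α) (hα₁ : α ≤ 1) (hP : 0 < P)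
    (hQ : 0 ≤ Q) (hτ : 0 ≤ τ) :
    IntegrableOn (fun u => betaWeight α u * (P + Q * u) ^ (-α - 1 - τ)) (Ioo 0 1) ∧
    ∫ u in Ioo (0 : ℝ) 1, betaWeight α u * (P + Q * u) ^ (-α - 1 - τ) ≤
      2 ^ (2 - α) / α * (P + Q) ^ (-α) * P ^ (-1 - τ) := by
  obtain ⟨hi, he⟩ := integrableOn_rpow_mul_add_mul_rpow hα hP hQ
  set g : ℝ → ℝ := fun u => u ^ (α - 1) * (P + Q * u) ^ (-α - 1) with hg
  have hi' : IntervalIntegrable g volume 0 1 :=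
    (intervalIntegrable_iff_integrableOn_Ioo_of_le zero_le_one).2 hi
  have hr : IntegrableOn (fun u => g (1 - u)) (Ioo 0 1) := by
    have := hi'.comp_sub_left 1
    rw [sub_zero, sub_self] at this
    exact (intervalIntegrable_iff_integrableOn_Ioo_of_le zero_le_one).1 this.symm
  have her : ∫ u in Ioo (0 : ℝ) 1, g (1 - u) = ∫ u in Ioo (0 : ℝ) 1, g u := by
    rw [← integral_Ioc_eq_integral_Ioo, ← integral_Ioc_eq_integral_Ioo,
      ← intervalIntegral.integral_of_le zero_le_one,
      ← intervalIntegral.integral_of_le zero_le_one, intervalIntegral.integral_comp_sub_left]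
    simp
  have hpos : ∀ u ∈ Ioo (0 : ℝ) 1, P ≤ P + Q * u := fun u hu => by
    have := mul_nonneg hQ hu.1.le
    linarith
  set B : ℝ → ℝ := fun u => 2 ^ (1 - α) * P ^ (-τ) * (g u + g (1 - u)) with hB
  have hBi : IntegrableOn B (Ioo 0 1) := (hi.add hr).const_mul _
  have hle : ∀ u ∈ Ioo (0 : ℝ) 1,
      betaWeight α u * (P + Q * u) ^ (-α - 1 - τ) ≤ B u := by
    intro u hu
    have hp := hP.trans_le (hpos u hu)
    have h1 : (P + Q * u) ^ (-α - 1 - τ) ≤ (P + Q * u) ^ (-α - 1) * P ^ (-τ) := by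
      rw [sub_eq_add_neg _ τ, Real.rpow_add hp]
      exact mul_le_mul_of_nonneg_left
        (Real.rpow_le_rpow_of_nonpos hP (hpos u hu) (by linarith)) (Real.rpow_nonneg hp.le _)
    have h2 := betaWeight_mul_le (α := α) (f := fun u => (P + Q * u) ^ (-α - 1)) hα₁
      (fun u hu v hv huv => Real.rpow_le_rpow_of_nonpos (hP.trans_le (hpos u hu))
        (by nlinarith) (by linarith))
      (fun u hu => Real.rpow_nonneg (hP.le.trans (hpos u hu)) _) hu
    calc _ ≤ betaWeight α u * ((P + Q * u) ^ (-α - 1) * P ^ (-τ)) :=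
          mul_le_mul_of_nonneg_left h1 (betaWeight_nonneg α hu)
      _ = betaWeight α u * (P + Q * u) ^ (-α - 1) * P ^ (-τ) := by ring
      _ ≤ 2 ^ (1 - α) * (u ^ (α - 1) * (P + Q * u) ^ (-α - 1) +
            (1 - u) ^ (α - 1) * (P + Q * (1 - u)) ^ (-α - 1)) * P ^ (-τ) :=
          mul_le_mul_of_nonneg_right h2 (Real.rpow_nonneg hP.le _)
      _ = B u := by simp only [hB, hg]; ring
  have hInt : IntegrableOn (fun u => betaWeight α u * (P + Q * u) ^ (-α - 1 - τ)) (Ioo 0 1) := by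
    refine hBi.mono' (Measurable.aestronglyMeasurable (by fun_prop)) ?_
    refine (ae_restrict_iff' measurableSet_Ioo).2 (Filter.Eventually.of_forall fun u hu => ?_)
    rw [Real.norm_of_nonneg (mul_nonneg (betaWeight_nonneg α hu)
      (Real.rpow_nonneg (hP.le.trans (hpos u hu)) _))]
    exact hle u hu
  refine ⟨hInt, (setIntegral_mono_on hInt hBi measurableSet_Ioo hle).trans_eq ?_⟩
  simp only [hB]
  rw [integral_const_mul, integral_add hi hr, her, he]
  have e1 : (2 : ℝ) ^ (2 - α) = 2 ^ (1 - α) * 2 := by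
    rw [← Real.rpow_add_one two_ne_zero]; ring_nf
  have e2 : P ^ (-τ) = P ^ (-1 - τ) * P := by
    rw [← Real.rpow_add_one hP.ne']; ring_nf
  rw [e1, e2]
  field_simp
  ring

theorem rpow_two_mul_mul_rpow_neg_le {α x T : ℝ} (hα : 0 ≤ α) (hx : 0 ≤ x) (hT : 0 < T)
    (h : x ^ 2 ≤ T) : x ^ (2 * α) * T ^ (-α) ≤ 1 := by
  rw [Real.rpow_neg hT.le, ← div_eq_mul_inv, div_le_one (Real.rpow_pos_of_pos hT _),
    Real.rpow_mul hx, Real.rpow_two]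
  exact Real.rpow_le_rpow (by positivity) h hα

/-! ### Weighted kernel bounds on the unit square -/

/-- The open unit square. -/
abbrev unitSquare : Set (ℝ × ℝ) := Ioo (0 : ℝ) 1 ×ˢ Ioo (0 : ℝ) 1

theorem integrableOn_betaWeight_mul_betaWeight {α β : ℝ} (hα : 0 < α) (hβ : 0 < β) :
    IntegrableOn (fun p : ℝ × ℝ => betaWeight α p.1 * betaWeight β p.2) unitSquare := by
  rw [IntegrableOn, Measure.volume_eq_prod, ← Measure.prod_restrict]
  exact (integrableOn_betaWeight hα).mul_prod (integrableOn_betaWeight hβ)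

theorem integrableOn_kernel {α β P Q₁ Q₂ γ : ℝ} (hα : 0 < α) (hβ : 0 < β) (hP : 0 < P)
    (hQ₁ : 0 ≤ Q₁) (hQ₂ : 0 ≤ Q₂) (hγ : 0 ≤ γ) :
    IntegrableOn (fun p : ℝ × ℝ => betaWeight α p.1 * betaWeight β p.2 *
      (P + Q₁ * p.1 + Q₂ * p.2) ^ (-γ)) unitSquare := by
  refine ((integrableOn_betaWeight_mul_betaWeight hα hβ).mul_const (P ^ (-γ))).mono'
    (Measurable.aestronglyMeasurable (by fun_prop)) ?_
  refine (ae_restrict_iff' (measurableSet_Ioo.prod measurableSet_Ioo)).2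
    (Filter.Eventually.of_forall fun p hp => ?_)
  have h1 := mul_nonneg hQ₁ hp.1.1.le
  have h2 := mul_nonneg hQ₂ hp.2.1.le
  have h3 := betaWeight_nonneg α hp.1
  have h4 := betaWeight_nonneg β hp.2
  rw [Real.norm_of_nonneg (by positivity)]
  exact mul_le_mul_of_nonneg_left
    (Real.rpow_le_rpow_of_nonpos hP (by linarith) (by linarith)) (by positivity)

/-- The sharp bound of the kernel of exponent `α + β + 1`. -/
theorem rpow_mul_setIntegral_kernel_add_one_le {α β P Q₁ Q₂ x y : ℝ} (hα : 0 < α) (hα₁ : α ≤ 1)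
    (hβ : 0 < β) (hβ₁ : β ≤ 1) (hP : 0 < P) (hQ₁ : 0 ≤ Q₁) (hQ₂ : 0 ≤ Q₂) (hx : 0 ≤ x)
    (hy : 0 ≤ y) (hxP : x ^ 2 ≤ P + Q₁) (hyP : y ^ 2 ≤ P + Q₂) :
    x ^ (2 * α) * y ^ (2 * β) * ∫ p in unitSquare, betaWeight α p.1 * betaWeight β p.2 *
      (P + Q₁ * p.1 + Q₂ * p.2) ^ (-(α + β + 1)) ≤
      2 ^ (2 - α) / α * (2 ^ (2 - β) / β) / P := by
  have hint := integrableOn_kernel (γ := α + β + 1) hα hβ hP hQ₁ hQ₂ (by linarith)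
  rw [IntegrableOn, Measure.volume_eq_prod, ← Measure.prod_restrict] at hint
  have e : ∫ p in unitSquare, betaWeight α p.1 * betaWeight β p.2 *
      (P + Q₁ * p.1 + Q₂ * p.2) ^ (-(α + β + 1)) =
      ∫ v in Ioo (0 : ℝ) 1, ∫ u in Ioo (0 : ℝ) 1, betaWeight α u * betaWeight β v *
      (P + Q₁ * u + Q₂ * v) ^ (-(α + β + 1)) := by
    rw [Measure.volume_eq_prod, ← Measure.prod_restrict, integral_prod_symm _ hint]
  have hx2 := Real.rpow_nonneg hx (2 * α)
  have hy2 := Real.rpow_nonneg hy (2 * β)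
  obtain ⟨hoi, hol⟩ := setIntegral_betaWeight_mul_rpow_le hβ hβ₁ hP hQ₂ le_rfl
  have inner : ∀ v ∈ Ioo (0 : ℝ) 1,
      x ^ (2 * α) * ∫ u in Ioo (0 : ℝ) 1, betaWeight α u * betaWeight β v *
        (P + Q₁ * u + Q₂ * v) ^ (-(α + β + 1)) ≤
      2 ^ (2 - α) / α * (betaWeight β v * (P + Q₂ * v) ^ (-β - 1 - 0)) := by
    intro v hv
    have hv2 := mul_nonneg hQ₂ hv.1.le
    have hP' : 0 < P + Q₂ * v := by linarith
    -- With `P + Q₂ v` in the role of `P` and excess `τ = β`, the `u`-integral leaves `(P + Q₂ v) ^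
    -- (-1 - β)`, which is exactly the `τ = 0` kernel for the `v`-integral.
    have h := (setIntegral_betaWeight_mul_rpow_le (τ := β) hα hα₁ hP' hQ₁ hβ.le).2
    have e2 : ∀ u, betaWeight α u * betaWeight β v * (P + Q₁ * u + Q₂ * v) ^ (-(α + β + 1)) =
        betaWeight β v * (betaWeight α u * (P + Q₂ * v + Q₁ * u) ^ (-α - 1 - β)) := by
      intro u
      rw [show P + Q₁ * u + Q₂ * v = P + Q₂ * v + Q₁ * u by ring,
        show -(α + β + 1) = -α - 1 - β by ring]
      ring
    simp only [e2, integral_const_mul]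
    have h3 := rpow_two_mul_mul_rpow_neg_le hα.le hx (by linarith : 0 < P + Q₂ * v + Q₁)
      (by linarith)
    have hb := betaWeight_nonneg β hv
    calc _ ≤ x ^ (2 * α) * (betaWeight β v * (2 ^ (2 - α) / α * (P + Q₂ * v + Q₁) ^ (-α) *
          (P + Q₂ * v) ^ (-1 - β))) := by gcongr
      _ = (x ^ (2 * α) * (P + Q₂ * v + Q₁) ^ (-α)) * (2 ^ (2 - α) / α * (betaWeight β v *
          (P + Q₂ * v) ^ (-1 - β))) := by ring
      _ ≤ 1 * (2 ^ (2 - α) / α * (betaWeight β v * (P + Q₂ * v) ^ (-1 - β))) := by gcongr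
      _ = _ := by rw [one_mul, show -1 - β = -β - 1 - 0 by ring]
  have outer : x ^ (2 * α) * ∫ p in unitSquare, betaWeight α p.1 * betaWeight β p.2 *
      (P + Q₁ * p.1 + Q₂ * p.2) ^ (-(α + β + 1)) ≤ 2 ^ (2 - α) / α *
      (2 ^ (2 - β) / β * (P + Q₂) ^ (-β) * P ^ (-1 - (0 : ℝ))) := by
    rw [e, ← integral_const_mul]
    refine (setIntegral_mono_on (hint.integral_prod_right.const_mul _) (hoi.const_mul _)
      measurableSet_Ioo inner).trans ?_
    rw [integral_const_mul]
    gcongr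
  have h3 := rpow_two_mul_mul_rpow_neg_le hβ.le hy (by linarith : 0 < P + Q₂) hyP
  calc _ = y ^ (2 * β) * (x ^ (2 * α) * ∫ p in unitSquare, betaWeight α p.1 * betaWeight β p.2 *
      (P + Q₁ * p.1 + Q₂ * p.2) ^ (-(α + β + 1))) := by ring
    _ ≤ y ^ (2 * β) * (2 ^ (2 - α) / α *
      (2 ^ (2 - β) / β * (P + Q₂) ^ (-β) * P ^ (-1 - (0 : ℝ)))) := by gcongr
    _ = (y ^ (2 * β) * (P + Q₂) ^ (-β)) * (2 ^ (2 - α) / α * (2 ^ (2 - β) / β) *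
        P ^ (-1 - (0 : ℝ))) := by ring
    _ ≤ 1 * (2 ^ (2 - α) / α * (2 ^ (2 - β) / β) * P ^ (-1 - (0 : ℝ))) := by gcongr
    _ = _ := by rw [sub_zero, Real.rpow_neg_one]; ring

/-- The bound of the kernel of exponent `α + β`. -/
theorem rpow_mul_setIntegral_kernel_le {α β P Q₁ Q₂ x y : ℝ} (hα : 0 < α)
    (hβ : 0 < β) (hP : 0 < P) (hQ₁ : 0 ≤ Q₁) (hQ₂ : 0 ≤ Q₂) (hx : 0 < x)
    (hy : 0 < y) (hxP : x ^ 2 ≤ P + Q₁) (hyP : y ^ 2 ≤ P + Q₂) :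
    x ^ (2 * α) * y ^ (2 * β) * ∫ p in unitSquare, betaWeight α p.1 * betaWeight β p.2 *
      (P + Q₁ * p.1 + Q₂ * p.2) ^ (-(α + β)) ≤
      (∫ u in Ioo (0 : ℝ) 1, betaWeight α u * u ^ (-(α / 2))) *
      (∫ v in Ioo (0 : ℝ) 1, betaWeight β v * v ^ (-(β / 2))) *
      (x ^ α * y ^ β * P ^ (-((α + β) / 2))) := by
  have hi : IntegrableOn (fun p : ℝ × ℝ => (betaWeight α p.1 * p.1 ^ (-(α / 2))) *
      (betaWeight β p.2 * p.2 ^ (-(β / 2)))) unitSquare := by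
    rw [IntegrableOn, Measure.volume_eq_prod, ← Measure.prod_restrict]
    exact (integrableOn_betaWeight_mul_rpow hα).mul_prod (integrableOn_betaWeight_mul_rpow hβ)
  -- The exponent `α + β` is split three ways: half of it goes to `R ≥ P`, and `α / 2`, `β / 2` go
  -- to `R ≥ u x²`, `R ≥ v y²`. The last two leave `u ^ (-(α / 2))` and `v ^ (-(β / 2))`, still
  -- integrable against the Beta weights.
  have hcoord : ∀ {γ z t R : ℝ}, 0 < γ → 0 < z → 0 < t → t * z ^ 2 ≤ R →
      R ^ (-(γ / 2)) ≤ z ^ (-γ) * t ^ (-(γ / 2)) := by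
    intro γ z t R hγ hz ht h
    refine (Real.rpow_le_rpow_of_nonpos (by positivity) h (by linarith)).trans_eq ?_
    rw [Real.mul_rpow ht.le (by positivity), ← Real.rpow_two, ← Real.rpow_mul hz.le, mul_comm]
    ring_nf
  have hpt : ∀ p ∈ unitSquare, betaWeight α p.1 * betaWeight β p.2 *
      (P + Q₁ * p.1 + Q₂ * p.2) ^ (-(α + β)) ≤ (x ^ (-α) * y ^ (-β) * P ^ (-((α + β) / 2))) *
      ((betaWeight α p.1 * p.1 ^ (-(α / 2))) * (betaWeight β p.2 * p.2 ^ (-(β / 2)))) := by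
    intro p hp
    have h1 := mul_nonneg hQ₁ hp.1.1.le
    have h2 := mul_nonneg hQ₂ hp.2.1.le
    have h3 := betaWeight_nonneg α hp.1
    have h4 := betaWeight_nonneg β hp.2
    have hR : 0 < P + Q₁ * p.1 + Q₂ * p.2 := by linarith
    set R := P + Q₁ * p.1 + Q₂ * p.2 with hRdef
    have b0 : R ^ (-((α + β) / 2)) ≤ P ^ (-((α + β) / 2)) :=
      Real.rpow_le_rpow_of_nonpos hP (by linarith) (by linarith)
    have b1 := hcoord (R := R) hα hx hp.1.1 (by nlinarith [hp.1.1, hp.1.2])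
    have b2 := hcoord (R := R) hβ hy hp.2.1 (by nlinarith [hp.2.1, hp.2.2])
    have e : R ^ (-(α + β)) = R ^ (-((α + β) / 2)) * (R ^ (-(α / 2)) * R ^ (-(β / 2))) := by
      rw [← Real.rpow_add hR, ← Real.rpow_add hR]; ring_nf
    have i1 := hp.1.1
    have i2 := hp.2.1
    calc _ = betaWeight α p.1 * betaWeight β p.2 *
          (R ^ (-((α + β) / 2)) * (R ^ (-(α / 2)) * R ^ (-(β / 2)))) := by rw [e]
      _ ≤ betaWeight α p.1 * betaWeight β p.2 * (P ^ (-((α + β) / 2)) *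
          ((x ^ (-α) * p.1 ^ (-(α / 2))) * (y ^ (-β) * p.2 ^ (-(β / 2))))) := by gcongr
      _ = _ := by ring
  have h := setIntegral_mono_on (integrableOn_kernel (γ := α + β) hα hβ hP hQ₁ hQ₂ (by linarith))
    (hi.const_mul _) (measurableSet_Ioo.prod measurableSet_Ioo) hpt
  rw [integral_const_mul, Measure.volume_eq_prod, setIntegral_prod_mul
    (fun u : ℝ => betaWeight α u * u ^ (-(α / 2)))
    (fun v : ℝ => betaWeight β v * v ^ (-(β / 2)))] at h
  have e1 : x ^ (2 * α) * x ^ (-α) = x ^ α := by rw [← Real.rpow_add hx]; ring_nf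
  have e2 : y ^ (2 * β) * y ^ (-β) = y ^ β := by rw [← Real.rpow_add hy]; ring_nf
  refine (mul_le_mul_of_nonneg_left h (by positivity)).trans_eq ?_
  rw [← e1, ← e2]
  ring

/-! ### Integral formulas for `q₁` and its first derivatives -/

/-- Serves both partial derivatives: `t` is the moving coordinate, `φ` the Euler variable paired
with it, and `ψ` the part of the base that does not move. -/
theorem hasDerivAt_setIntegral_kernel {w φ ψ : ℝ × ℝ → ℝ} {γ t t₀ c : ℝ} (hw : Measurable w)
    (hwi : IntegrableOn w unitSquare) (hφ : Measurable φ) (hψ : Measurable ψ)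
    (hφ₀ : ∀ p ∈ unitSquare, 0 ≤ φ p) (hφ₁ : ∀ p ∈ unitSquare, φ p ≤ 1)
    (hψc : ∀ p ∈ unitSquare, c ≤ ψ p) (hγ : 0 ≤ γ) (ht : 0 < t) (ht₀ : 0 ≤ t₀)
    (hc : 0 < (t - t₀) ^ 2 + c) :
    HasDerivAt (fun t => ∫ p in unitSquare, w p * ((t - t₀) ^ 2 + 4 * t * t₀ * φ p + ψ p) ^ (-γ))
      (∫ p in unitSquare, w p * (-γ * ((t - t₀) ^ 2 + 4 * t * t₀ * φ p + ψ p) ^ (-γ - 1) *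
        (2 * (t - t₀) + 4 * t₀ * φ p))) t := by
  set m := ((t - t₀) ^ 2 + c) / 2 with hm
  have hm0 : 0 < m := by positivity
  have hsq : MeasurableSet unitSquare := measurableSet_Ioo.prod measurableSet_Ioo
  -- On this neighbourhood the base stays above `m` and the factor linear in `t` stays bounded,
  -- which gives a dominating function.
  set s : Set ℝ := {x | 0 < x ∧ m < (x - t₀) ^ 2 + c ∧ x < t + 1} with hs
  have hsopen : IsOpen s := by
    refine (isOpen_lt continuous_const continuous_id).and
      ((isOpen_lt continuous_const ?_).and (isOpen_lt continuous_id continuous_const))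
    fun_prop
  have hsn : s ∈ nhds t := hsopen.mem_nhds ⟨ht, by rw [hm]; linarith, by linarith⟩
  have hR : ∀ x ∈ s, ∀ p ∈ unitSquare, m ≤ (x - t₀) ^ 2 + 4 * x * t₀ * φ p + ψ p := by
    intro x hx p hp
    have h1 : 0 ≤ 4 * x * t₀ * φ p :=
      mul_nonneg (mul_nonneg (by linarith [hx.1]) ht₀) (hφ₀ p hp)
    linarith [hx.2.1, hψc p hp]
  have hae : ∀ {q : ℝ × ℝ → Prop}, (∀ p ∈ unitSquare, q p) →
      ∀ᵐ p ∂(volume.restrict unitSquare), q p := fun h =>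
    (ae_restrict_iff' hsq).2 (Filter.Eventually.of_forall h)
  have main := hasDerivAt_integral_of_dominated_loc_of_deriv_le
    (μ := volume.restrict unitSquare) (s := s) (x₀ := t)
    (F := fun t p => w p * ((t - t₀) ^ 2 + 4 * t * t₀ * φ p + ψ p) ^ (-γ))
    (F' := fun t p => w p * (-γ * ((t - t₀) ^ 2 + 4 * t * t₀ * φ p + ψ p) ^ (-γ - 1) *
        (2 * (t - t₀) + 4 * t₀ * φ p)))
    (bound := fun p => |w p| * (γ * m ^ (-γ - 1) * (2 * (t + 1 + t₀) + 4 * t₀)))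
    hsn
    (Filter.Eventually.of_forall fun x => Measurable.aestronglyMeasurable (by fun_prop))
    (by
      refine (hwi.abs.mul_const (m ^ (-γ))).mono'
        (Measurable.aestronglyMeasurable (by fun_prop)) (hae fun p hp => ?_)
      have h1 := hR t (mem_of_mem_nhds hsn) p hp
      rw [norm_mul, Real.norm_eq_abs, Real.norm_of_nonneg (Real.rpow_nonneg (hm0.le.trans h1) _)]
      exact mul_le_mul_of_nonneg_left
        (Real.rpow_le_rpow_of_nonpos hm0 h1 (by linarith)) (abs_nonneg _))
    (Measurable.aestronglyMeasurable (by fun_prop))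
    (hae fun p hp x hx => by
      have h1 := hR x hx p hp
      have h2 : |2 * (x - t₀) + 4 * t₀ * φ p| ≤ 2 * (t + 1 + t₀) + 4 * t₀ := by
        have h3 : 0 ≤ t₀ * φ p := mul_nonneg ht₀ (hφ₀ p hp)
        have h4 : t₀ * φ p ≤ t₀ := mul_le_of_le_one_right ht₀ (hφ₁ p hp)
        rw [abs_le]
        constructor <;> nlinarith [hx.1, hx.2.2]
      rw [norm_mul, norm_mul, norm_mul, norm_neg, Real.norm_eq_abs, Real.norm_of_nonneg hγ,
        Real.norm_of_nonneg (Real.rpow_nonneg (hm0.le.trans h1) _), Real.norm_eq_abs]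
      have h5 := Real.rpow_le_rpow_of_nonpos hm0 h1 (by linarith : -γ - 1 ≤ 0)
      have h6 := Real.rpow_nonneg hm0.le (-γ - 1)
      gcongr)
    (hwi.abs.mul_const _)
    (hae fun p hp x hx => by
      have h1 := hm0.trans_le (hR x hx p hp)
      have d : HasDerivAt (fun x => (x - t₀) ^ 2 + 4 * x * t₀ * φ p + ψ p)
          (2 * (x - t₀) + 4 * t₀ * φ p) x := by
        have d1 := ((hasDerivAt_id x).sub_const t₀).pow 2
        have d2 := (((hasDerivAt_id x).const_mul 4).mul_const t₀).mul_const (φ p)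
        refine ((d1.add d2).add_const (ψ p)).congr_deriv ?_
        simp
      refine ((d.rpow_const (p := -γ) (Or.inl h1.ne')).const_mul (w p)).congr_deriv ?_
      ring)
  exact main.2

/-- The constant in front of the double integral in `q₁_eq`. -/
noncomputable def kernelConst (α β : ℝ) : ℝ :=
  k₁ α β * (Real.Gamma (2 * α) / (Real.Gamma α * Real.Gamma (2 * α - α)) *
    (Real.Gamma (2 * β) / (Real.Gamma β * Real.Gamma (2 * β - β))))

/-- `q₁` as a double integral without singular denominators. -/
theorem q₁_eq {α β x y x₀ y₀ : ℝ} (hx : 0 ≤ x) (hy : 0 ≤ y) (hx₀ : 0 ≤ x₀) (hy₀ : 0 ≤ y₀)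
    (hr : 0 < (x - x₀) ^ 2 + (y - y₀) ^ 2) :
    q₁ α β x y x₀ y₀ = kernelConst α β * ∫ p in unitSquare, betaWeight α p.1 * betaWeight β p.2 *
      ((x - x₀) ^ 2 + (y - y₀) ^ 2 + 4 * x * x₀ * p.1 + 4 * y * y₀ * p.2) ^ (-(α + β)) := by
  unfold q₁ appellF2 kernelConst
  simp only
  set r := (x - x₀) ^ 2 + (y - y₀) ^ 2 with hrdef
  have e : ∫ p in unitSquare, betaWeight α p.1 * betaWeight β p.2 *
      (r + 4 * x * x₀ * p.1 + 4 * y * y₀ * p.2) ^ (-(α + β)) =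
      r ^ (-α - β) * ∫ p in unitSquare,
      (p.1 ^ (α - 1) * (1 - p.1) ^ (2 * α - α - 1)) *
      (p.2 ^ (β - 1) * (1 - p.2) ^ (2 * β - β - 1)) *
      (1 - p.1 * ((r - ((x + x₀) ^ 2 + (y - y₀) ^ 2)) / r) -
        p.2 * ((r - ((x - x₀) ^ 2 + (y + y₀) ^ 2)) / r)) ^ (-(α + β)) := by
    rw [← integral_const_mul]
    refine setIntegral_congr_fun (measurableSet_Ioo.prod measurableSet_Ioo) fun p hp => ?_
    have h1 := hp.1.1
    have h2 := hp.2.1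
    -- Here `r² - r₁² = -4 x x₀` and `r² - r₂² = -4 y y₀`, so the base of Euler's integrand is `R /
    -- r²` and the prefactor of `q₁` cancels the denominator.
    have e1 : 1 - p.1 * ((r - ((x + x₀) ^ 2 + (y - y₀) ^ 2)) / r) -
        p.2 * ((r - ((x - x₀) ^ 2 + (y + y₀) ^ 2)) / r) =
        (r + 4 * x * x₀ * p.1 + 4 * y * y₀ * p.2) / r := by
      field_simp
      rw [hrdef]
      ring
    have e2 : (r + 4 * x * x₀ * p.1 + 4 * y * y₀ * p.2) ^ (-(α + β)) = r ^ (-α - β) *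
        ((r + 4 * x * x₀ * p.1 + 4 * y * y₀ * p.2) / r) ^ (-(α + β)) := by
      rw [show -α - β = -(α + β) by ring, ← Real.mul_rpow hr.le (by positivity),
        mul_div_cancel₀ _ hr.ne']
    simp only [e1, e2, betaWeight, show 2 * α - α - 1 = α - 1 by ring,
      show 2 * β - β - 1 = β - 1 by ring]
    ring
  rw [e]
  ring

theorem measurable_betaWeight_mul (α β : ℝ) :
    Measurable fun p : ℝ × ℝ => betaWeight α p.1 * betaWeight β p.2 := by
  fun_prop

theorem hasDerivAt_q₁_fst {α β x y x₀ y₀ : ℝ} (hα : 0 < α) (hβ : 0 < β) (hx : 0 < x) (hy : 0 < y)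
    (hx₀ : 0 ≤ x₀) (hy₀ : 0 ≤ y₀) (hr : 0 < (x - x₀) ^ 2 + (y - y₀) ^ 2) :
    HasDerivAt (fun x => q₁ α β x y x₀ y₀) (kernelConst α β *
      ∫ p in unitSquare, betaWeight α p.1 * betaWeight β p.2 * (-(α + β) *
      ((x - x₀) ^ 2 + (y - y₀) ^ 2 + 4 * x * x₀ * p.1 + 4 * y * y₀ * p.2) ^ (-(α + β + 1)) *
      (2 * (x - x₀) + 4 * x₀ * p.1))) x := by
  have h := hasDerivAt_setIntegral_kernel (φ := fun p => p.1)
    (ψ := fun p => (y - y₀) ^ 2 + 4 * y * y₀ * p.2) (c := (y - y₀) ^ 2) (γ := α + β)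
    (measurable_betaWeight_mul α β) (integrableOn_betaWeight_mul_betaWeight hα hβ)
    (by fun_prop) (by fun_prop) (fun p hp => hp.1.1.le) (fun p hp => hp.1.2.le)
    (fun p hp => le_add_of_nonneg_right (mul_nonneg (by positivity) hp.2.1.le))
    (by positivity) hx hx₀ hr
  -- `q₁_eq` is available only inside the quadrant and off the pole; both are open conditions, so
  -- the two functions agree near `x`.
  have hev : ∀ᶠ z in nhds x, 0 < z ∧ 0 < (z - x₀) ^ 2 + (y - y₀) ^ 2 :=
    (lt_mem_nhds hx).and (ContinuousAt.eventually_lt (by fun_prop) (by fun_prop) hr)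
  refine ((h.const_mul (kernelConst α β)).congr_of_eventuallyEq ?_).congr_deriv ?_
  · filter_upwards [hev] with z hz
    rw [q₁_eq hz.1.le hy.le hx₀ hy₀ hz.2]
    refine congrArg _ (integral_congr_ae (Filter.Eventually.of_forall fun p => ?_))
    simp only
    ring_nf
  · refine congrArg _ (integral_congr_ae (Filter.Eventually.of_forall fun p => ?_))
    simp only
    ring_nf

theorem hasDerivAt_q₁_snd {α β x y x₀ y₀ : ℝ} (hα : 0 < α) (hβ : 0 < β) (hx : 0 < x) (hy : 0 < y)
    (hx₀ : 0 ≤ x₀) (hy₀ : 0 ≤ y₀) (hr : 0 < (x - x₀) ^ 2 + (y - y₀) ^ 2) :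
    HasDerivAt (fun y => q₁ α β x y x₀ y₀) (kernelConst α β *
      ∫ p in unitSquare, betaWeight α p.1 * betaWeight β p.2 * (-(α + β) *
      ((x - x₀) ^ 2 + (y - y₀) ^ 2 + 4 * x * x₀ * p.1 + 4 * y * y₀ * p.2) ^ (-(α + β + 1)) *
      (2 * (y - y₀) + 4 * y₀ * p.2))) y := by
  have h := hasDerivAt_setIntegral_kernel (φ := fun p => p.2)
    (ψ := fun p => (x - x₀) ^ 2 + 4 * x * x₀ * p.1) (c := (x - x₀) ^ 2) (γ := α + β)
    (measurable_betaWeight_mul α β) (integrableOn_betaWeight_mul_betaWeight hα hβ)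
    (by fun_prop) (by fun_prop) (fun p hp => hp.2.1.le) (fun p hp => hp.2.2.le)
    (fun p hp => le_add_of_nonneg_right (mul_nonneg (by positivity) hp.1.1.le))
    (by positivity) hy hy₀ (by rwa [add_comm])
  have hev : ∀ᶠ z in nhds y, 0 < z ∧ 0 < (x - x₀) ^ 2 + (z - y₀) ^ 2 :=
    (lt_mem_nhds hy).and (ContinuousAt.eventually_lt (by fun_prop) (by fun_prop) hr)
  refine ((h.const_mul (kernelConst α β)).congr_of_eventuallyEq ?_).congr_deriv ?_
  · filter_upwards [hev] with z hz
    rw [q₁_eq hx.le hz.1.le hx₀ hy₀ hz.2]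
    refine congrArg _ (integral_congr_ae (Filter.Eventually.of_forall fun p => ?_))
    simp only
    ring_nf
  · refine congrArg _ (integral_congr_ae (Filter.Eventually.of_forall fun p => ?_))
    simp only
    ring_nf

/-- The derivative of `q₁` in the direction `(a, b)`, as a double integral. -/
noncomputable def kernelDeriv (α β x y x₀ y₀ a b : ℝ) : ℝ :=
  kernelConst α β * ∫ p in unitSquare, betaWeight α p.1 * betaWeight β p.2 * (-(α + β) *
    ((x - x₀) ^ 2 + (y - y₀) ^ 2 + 4 * x * x₀ * p.1 + 4 * y * y₀ * p.2) ^ (-(α + β + 1)) *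
    (a * (2 * (x - x₀) + 4 * x₀ * p.1) + b * (2 * (y - y₀) + 4 * y₀ * p.2)))

theorem integrableOn_kernel_mul {α β P Q₁ Q₂ γ C : ℝ} {f : ℝ × ℝ → ℝ} (hα : 0 < α) (hβ : 0 < β)
    (hP : 0 < P) (hQ₁ : 0 ≤ Q₁) (hQ₂ : 0 ≤ Q₂) (hγ : 0 ≤ γ) (hf : Measurable f)
    (hC : ∀ p ∈ unitSquare, |f p| ≤ C) :
    IntegrableOn (fun p : ℝ × ℝ => betaWeight α p.1 * betaWeight β p.2 * (-(α + β) *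
      (P + Q₁ * p.1 + Q₂ * p.2) ^ (-γ) * f p)) unitSquare := by
  refine ((integrableOn_kernel hα hβ hP hQ₁ hQ₂ hγ).norm.mul_const ((α + β) * C)).mono'
    (Measurable.aestronglyMeasurable (by fun_prop)) ?_
  refine (ae_restrict_iff' (measurableSet_Ioo.prod measurableSet_Ioo)).2
    (Filter.Eventually.of_forall fun p hp => ?_)
  have := hC p hp
  simp only [norm_mul, norm_neg, Real.norm_of_nonneg (add_pos hα hβ).le, Real.norm_eq_abs (f p)]
  calc _ = ‖betaWeight α p.1‖ * ‖betaWeight β p.2‖ *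
        ‖(P + Q₁ * p.1 + Q₂ * p.2) ^ (-γ)‖ * ((α + β) * |f p|) := by ring
    _ ≤ _ := by gcongr

theorem kernelDeriv_eq {α β x y x₀ y₀ : ℝ} (hα : 0 < α) (hβ : 0 < β) (hx : 0 < x) (hy : 0 < y)
    (hx₀ : 0 ≤ x₀) (hy₀ : 0 ≤ y₀) (hr : 0 < (x - x₀) ^ 2 + (y - y₀) ^ 2) (a b : ℝ) :
    kernelDeriv α β x y x₀ y₀ a b = a * deriv (fun x => q₁ α β x y x₀ y₀) x +
      b * deriv (fun y => q₁ α β x y x₀ y₀) y := by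
  rw [(hasDerivAt_q₁_fst hα hβ hx hy hx₀ hy₀ hr).deriv,
    (hasDerivAt_q₁_snd hα hβ hx hy hx₀ hy₀ hr).deriv, kernelDeriv]
  have bd : ∀ {d z t : ℝ}, 0 ≤ z → t ∈ Ioo (0 : ℝ) 1 →
      |2 * d + 4 * z * t| ≤ 2 * |d| + 4 * z := fun {d z t} hz ht => by
    refine (abs_add_le _ _).trans ?_
    rw [abs_mul, abs_mul, abs_of_pos ht.1, abs_of_nonneg (by positivity : 0 ≤ 4 * z), abs_two]
    exact add_le_add_right (mul_le_of_le_one_right (by positivity) ht.2.le) _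
  have i1 := integrableOn_kernel_mul (γ := α + β + 1) (f := fun p => 2 * (x - x₀) + 4 * x₀ * p.1)
    hα hβ hr (by positivity : 0 ≤ 4 * x * x₀) (by positivity : 0 ≤ 4 * y * y₀) (by positivity)
    (by fun_prop) (fun p hp => bd hx₀ hp.1)
  have i2 := integrableOn_kernel_mul (γ := α + β + 1) (f := fun p => 2 * (y - y₀) + 4 * y₀ * p.2)
    hα hβ hr (by positivity : 0 ≤ 4 * x * x₀) (by positivity : 0 ≤ 4 * y * y₀) (by positivity)
    (by fun_prop) (fun p hp => bd hy₀ hp.2)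
  rw [mul_left_comm a, mul_left_comm b, ← mul_add, ← integral_const_mul a, ← integral_const_mul b,
    ← integral_add (i1.const_mul a) (i2.const_mul b)]
  refine congrArg _ (integral_congr_ae (Filter.Eventually.of_forall fun p => ?_))
  simp only
  ring

theorem kernelConst_nonneg {α β : ℝ} (hα : 0 < α) (hβ : 0 < β) : 0 ≤ kernelConst α β := by
  unfold kernelConst k₁
  rw [show 2 * α - α = α by ring, show 2 * β - β = β by ring]
  have := Real.pi_pos
  have h1 := Real.Gamma_pos_of_pos hα
  have h2 := Real.Gamma_pos_of_pos hβ
  have h3 := Real.Gamma_pos_of_pos (add_pos hα hβ)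
  have h4 := Real.Gamma_pos_of_pos (mul_pos two_pos hα)
  have h5 := Real.Gamma_pos_of_pos (mul_pos two_pos hβ)
  positivity

/-! ### Pointwise bound of the weighted directional derivative -/

/-- The derivative of `R` is the double layer numerator plus terms in `x₀ u` and `y₀ v`. Since `4 x
x₀ u` and `4 y y₀ v` are summands of `R`, those terms are at most `R / x` and `R / y` times the
direction, which trades one power of `R` for `1 / x` and `1 / y`. -/
theorem abs_kernelDeriv_le {α β x y x₀ y₀ : ℝ} (hα : 0 < α) (hβ : 0 < β) (hx : 0 < x) (hy : 0 < y)
    (hx₀ : 0 ≤ x₀) (hy₀ : 0 ≤ y₀) (hr : 0 < (x - x₀) ^ 2 + (y - y₀) ^ 2) (a b : ℝ) :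
    |kernelDeriv α β x y x₀ y₀ a b| ≤ kernelConst α β * (α + β) *
      (2 * |a * (x - x₀) + b * (y - y₀)| *
        (∫ p in unitSquare, betaWeight α p.1 * betaWeight β p.2 *
          ((x - x₀) ^ 2 + (y - y₀) ^ 2 + 4 * x * x₀ * p.1 + 4 * y * y₀ * p.2) ^ (-(α + β + 1))) +
      (|a| / x + |b| / y) * ∫ p in unitSquare, betaWeight α p.1 * betaWeight β p.2 *
          ((x - x₀) ^ 2 + (y - y₀) ^ 2 + 4 * x * x₀ * p.1 + 4 * y * y₀ * p.2) ^ (-(α + β))) := by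
  have i1 := integrableOn_kernel (γ := α + β + 1) hα hβ hr (by positivity : 0 ≤ 4 * x * x₀)
    (by positivity : 0 ≤ 4 * y * y₀) (by positivity)
  have i2 := integrableOn_kernel (γ := α + β) hα hβ hr (by positivity : 0 ≤ 4 * x * x₀)
    (by positivity : 0 ≤ 4 * y * y₀) (by positivity)
  rw [kernelDeriv, abs_mul, abs_of_nonneg (kernelConst_nonneg hα hβ), mul_assoc (kernelConst α β)]
  refine mul_le_mul_of_nonneg_left ?_ (kernelConst_nonneg hα hβ)
  rw [← integral_const_mul (2 * |a * (x - x₀) + b * (y - y₀)|),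
    ← integral_const_mul (|a| / x + |b| / y), ← integral_add (i1.const_mul _) (i2.const_mul _),
    ← integral_const_mul (α + β), ← Real.norm_eq_abs]
  refine norm_integral_le_of_norm_le (((i1.const_mul _).add (i2.const_mul _)).const_mul _) ?_
  refine (ae_restrict_iff' (measurableSet_Ioo.prod measurableSet_Ioo)).2
    (Filter.Eventually.of_forall fun p hp => ?_)
  have h1 := hp.1.1
  have h2 := hp.2.1
  have h3 := betaWeight_nonneg α hp.1
  have h4 := betaWeight_nonneg β hp.2
  have hq1 : 0 ≤ 4 * x * x₀ * p.1 := by positivity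
  have hq2 : 0 ≤ 4 * y * y₀ * p.2 := by positivity
  set R := (x - x₀) ^ 2 + (y - y₀) ^ 2 + 4 * x * x₀ * p.1 + 4 * y * y₀ * p.2 with hR
  have hR0 : 0 < R := by linarith
  have e : R ^ (-(α + β)) = R ^ (-(α + β + 1)) * R := by
    rw [← Real.rpow_add_one hR0.ne']; ring_nf
  have k1 : 4 * x₀ * p.1 ≤ R / x := by
    rw [le_div_iff₀ hx]; linarith
  have k2 : 4 * y₀ * p.2 ≤ R / y := by
    rw [le_div_iff₀ hy]; linarith
  have hab : |a * (2 * (x - x₀) + 4 * x₀ * p.1) + b * (2 * (y - y₀) + 4 * y₀ * p.2)| ≤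
      2 * |a * (x - x₀) + b * (y - y₀)| + (|a| / x + |b| / y) * R := by
    have t1 : |a * (4 * x₀ * p.1)| ≤ |a| * (R / x) := by
      rw [abs_mul, abs_of_nonneg (by positivity : 0 ≤ 4 * x₀ * p.1)]
      gcongr
    have t2 : |b * (4 * y₀ * p.2)| ≤ |b| * (R / y) := by
      rw [abs_mul, abs_of_nonneg (by positivity : 0 ≤ 4 * y₀ * p.2)]
      gcongr
    calc _ = |2 * (a * (x - x₀) + b * (y - y₀)) + a * (4 * x₀ * p.1) + b * (4 * y₀ * p.2)| := by
          ring_nf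
      _ ≤ |2 * (a * (x - x₀) + b * (y - y₀))| + |a * (4 * x₀ * p.1)| + |b * (4 * y₀ * p.2)| :=
          abs_add_three _ _ _
      _ ≤ 2 * |a * (x - x₀) + b * (y - y₀)| + |a| * (R / x) + |b| * (R / y) := by
          rw [abs_mul 2, abs_two]; gcongr
      _ = _ := by ring
  have hRp := Real.rpow_nonneg hR0.le (-(α + β + 1))
  rw [norm_mul, norm_mul, norm_mul, norm_mul, norm_neg, Real.norm_of_nonneg h3,
    Real.norm_of_nonneg h4, Real.norm_of_nonneg hRp, Real.norm_of_nonneg (add_pos hα hβ).le,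
    Real.norm_eq_abs, e]
  calc _ ≤ betaWeight α p.1 * betaWeight β p.2 * ((α + β) * R ^ (-(α + β + 1)) *
      (2 * |a * (x - x₀) + b * (y - y₀)| + (|a| / x + |b| / y) * R)) := by gcongr
    _ = _ := by ring

/-- The pointwise bound of the weighted directional derivative of `q₁`, with constants depending
only on the exponents. -/
theorem exists_rpow_mul_abs_kernelDeriv_le {α β : ℝ} (hα : 0 < α) (hα₁ : α ≤ 1) (hβ : 0 < β)
    (hβ₁ : β ≤ 1) :
    ∃ C D : ℝ, 0 ≤ C ∧ 0 ≤ D ∧ ∀ x y x₀ y₀ a b : ℝ, 0 < x → 0 < y → 0 ≤ x₀ → 0 ≤ y₀ →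
      0 < (x - x₀) ^ 2 + (y - y₀) ^ 2 →
      x ^ (2 * α) * y ^ (2 * β) * |kernelDeriv α β x y x₀ y₀ a b| ≤
      C * (|a * (x - x₀) + b * (y - y₀)| / ((x - x₀) ^ 2 + (y - y₀) ^ 2)) +
      D * ((|a| / x + |b| / y) * (x ^ α * y ^ β *
        ((x - x₀) ^ 2 + (y - y₀) ^ 2) ^ (-((α + β) / 2)))) := by
  set A := 2 ^ (2 - α) / α * (2 ^ (2 - β) / β) with hA
  set B := (∫ u in Ioo (0 : ℝ) 1, betaWeight α u * u ^ (-(α / 2))) *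
      (∫ v in Ioo (0 : ℝ) 1, betaWeight β v * v ^ (-(β / 2))) with hB
  have hK := kernelConst_nonneg hα hβ
  have hBnn : 0 ≤ B :=
    mul_nonneg (setIntegral_nonneg measurableSet_Ioo fun u hu =>
        mul_nonneg (betaWeight_nonneg _ hu) (Real.rpow_nonneg hu.1.le _))
      (setIntegral_nonneg measurableSet_Ioo fun u hu =>
        mul_nonneg (betaWeight_nonneg _ hu) (Real.rpow_nonneg hu.1.le _))
  refine ⟨kernelConst α β * (α + β) * (2 * A), kernelConst α β * (α + β) * B, by positivity,
    by positivity, fun x y x₀ y₀ a b hx hy hx₀ hy₀ hr => ?_⟩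
  -- `P + Q₁` and `P + Q₂` are the squared distances `r₁²`, `r₂²` to the reflected poles, hence at
  -- least `x²` and `y²`.
  have b1 := rpow_mul_setIntegral_kernel_add_one_le hα hα₁ hβ hβ₁ hr
    (by positivity : 0 ≤ 4 * x * x₀) (by positivity : 0 ≤ 4 * y * y₀) hx.le hy.le
    (by nlinarith [sq_nonneg (y - y₀), mul_nonneg hx.le hx₀])
    (by nlinarith [sq_nonneg (x - x₀), mul_nonneg hy.le hy₀])
  have b2 := rpow_mul_setIntegral_kernel_le hα hβ hr
    (by positivity : 0 ≤ 4 * x * x₀) (by positivity : 0 ≤ 4 * y * y₀) hx hy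
    (by nlinarith [sq_nonneg (y - y₀), mul_nonneg hx.le hx₀])
    (by nlinarith [sq_nonneg (x - x₀), mul_nonneg hy.le hy₀])
  have b0 := abs_kernelDeriv_le hα hβ hx hy hx₀ hy₀ hr a b
  rw [← hA] at b1
  rw [← hB] at b2
  set r := (x - x₀) ^ 2 + (y - y₀) ^ 2
  set I₁ := ∫ p in unitSquare, betaWeight α p.1 * betaWeight β p.2 *
      (r + 4 * x * x₀ * p.1 + 4 * y * y₀ * p.2) ^ (-(α + β + 1))
  set I₂ := ∫ p in unitSquare, betaWeight α p.1 * betaWeight β p.2 *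
      (r + 4 * x * x₀ * p.1 + 4 * y * y₀ * p.2) ^ (-(α + β))
  calc _ ≤ x ^ (2 * α) * y ^ (2 * β) * (kernelConst α β * (α + β) *
        (2 * |a * (x - x₀) + b * (y - y₀)| * I₁ + (|a| / x + |b| / y) * I₂)) := by gcongr
    _ = kernelConst α β * (α + β) * (2 * |a * (x - x₀) + b * (y - y₀)| *
        (x ^ (2 * α) * y ^ (2 * β) * I₁) +
        (|a| / x + |b| / y) * (x ^ (2 * α) * y ^ (2 * β) * I₂)) := by ring
    _ ≤ kernelConst α β * (α + β) * (2 * |a * (x - x₀) + b * (y - y₀)| * (A / r) +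
        (|a| / x + |b| / y) * (B * (x ^ α * y ^ β * r ^ (-((α + β) / 2))))) := by gcongr
    _ = _ := by ring

/-! ### Geometry of the curve -/

/-- Mean value inequality applied twice: the second derivative is bounded by compactness, so `τ ↦ f
τ - f'(s) τ` has derivative at most `M |s - t|` between `s` and `t`. -/
theorem exists_abs_sub_sub_derivWithin_le {f : ℝ → ℝ} {l : ℝ} (hl : 0 < l)
    (hf : ContDiffOn ℝ 2 f (Icc 0 l)) :
    ∃ M : ℝ, 0 ≤ M ∧ ∀ s ∈ Icc 0 l, ∀ t ∈ Icc 0 l,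
      |f s - f t - derivWithin f (Icc 0 l) s * (s - t)| ≤ M * (s - t) ^ 2 := by
  have hu := uniqueDiffOn_Icc hl
  have h1 : ContDiffOn ℝ 1 (derivWithin f (Icc 0 l)) (Icc 0 l) :=
    hf.derivWithin hu (by norm_num)
  obtain ⟨M, hM⟩ := isCompact_Icc.exists_bound_of_continuousOn
    (h1.continuousOn_derivWithin hu le_rfl)
  have hM0 : 0 ≤ M := (norm_nonneg _).trans (hM 0 ⟨le_rfl, hl.le⟩)
  refine ⟨M, hM0, fun s hs t ht => ?_⟩
  have hsub : uIcc s t ⊆ Icc 0 l := (convex_Icc 0 l).ordConnected.uIcc_subset hs ht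
  have hd : ∀ τ ∈ uIcc s t, HasDerivWithinAt (fun τ => f τ - derivWithin f (Icc 0 l) s * τ)
      (derivWithin f (Icc 0 l) τ - derivWithin f (Icc 0 l) s) (uIcc s t) τ := by
    intro τ hτ
    have e := ((hf.differentiableOn (by norm_num)) τ (hsub hτ)).hasDerivWithinAt.mono hsub
    refine (e.sub ((hasDerivWithinAt_id τ _).const_mul (derivWithin f (Icc 0 l) s))).congr_deriv ?_
    simp
  have hb : ∀ τ ∈ uIcc s t,
      ‖derivWithin f (Icc 0 l) τ - derivWithin f (Icc 0 l) s‖ ≤ M * |s - t| := by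
    intro τ hτ
    refine ((convex_Icc 0 l).norm_image_sub_le_of_norm_derivWithin_le
      (h1.differentiableOn (by norm_num)) hM hs (hsub hτ)).trans ?_
    rw [Real.norm_eq_abs, abs_sub_comm s t]
    exact mul_le_mul_of_nonneg_left (abs_sub_left_of_mem_uIcc hτ) hM0
  have h := (convex_uIcc s t).norm_image_sub_le_of_norm_hasDerivWithin_le hd hb
    right_mem_uIcc left_mem_uIcc
  rw [Real.norm_eq_abs, Real.norm_eq_abs, mul_assoc, ← sq, sq_abs] at h
  refine le_trans (le_of_eq (congrArg _ ?_)) h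
  ring

namespace IsBoundaryCurve

variable {a b l : ℝ} {X Y : ℝ → ℝ}

theorem abs_derivWithin_X_le_one (hΓ : IsBoundaryCurve a b l X Y) {s : ℝ} (hs : s ∈ Icc 0 l) :
    |derivWithin X (Icc 0 l) s| ≤ 1 := by
  rw [← sq_le_one_iff_abs_le_one]
  nlinarith [hΓ.arcLength s hs, sq_nonneg (derivWithin Y (Icc 0 l) s)]

theorem abs_derivWithin_Y_le_one (hΓ : IsBoundaryCurve a b l X Y) {s : ℝ} (hs : s ∈ Icc 0 l) :
    |derivWithin Y (Icc 0 l) s| ≤ 1 := by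
  rw [← sq_le_one_iff_abs_le_one]
  nlinarith [hΓ.arcLength s hs, sq_nonneg (derivWithin X (Icc 0 l) s)]

theorem exists_taylor (hΓ : IsBoundaryCurve a b l X Y) :
    ∃ M : ℝ, 0 < M ∧ ∀ s ∈ Icc 0 l, ∀ t ∈ Icc 0 l,
      |X s - X t - derivWithin X (Icc 0 l) s * (s - t)| ≤ M * (s - t) ^ 2 ∧
      |Y s - Y t - derivWithin Y (Icc 0 l) s * (s - t)| ≤ M * (s - t) ^ 2 := by
  obtain ⟨M, hM, h⟩ := exists_abs_sub_sub_derivWithin_le hΓ.l_pos hΓ.contDiff_X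
  obtain ⟨N, hN, h'⟩ := exists_abs_sub_sub_derivWithin_le hΓ.l_pos hΓ.contDiff_Y
  refine ⟨M + N + 1, by positivity, fun s hs t ht => ⟨(h s hs t ht).trans ?_,
    (h' s hs t ht).trans ?_⟩⟩ <;> nlinarith [sq_nonneg (s - t)]

/-- The chord-arc inequality. -/
theorem exists_chord_arc (hΓ : IsBoundaryCurve a b l X Y) :
    ∃ c : ℝ, 0 < c ∧ c ≤ 1 ∧ ∀ s ∈ Icc 0 l, ∀ t ∈ Icc 0 l,
      c * (s - t) ^ 2 ≤ (X s - X t) ^ 2 + (Y s - Y t) ^ 2 := by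
  obtain ⟨M, hM, hT⟩ := hΓ.exists_taylor
  -- For `|s - t| ≤ h` each Taylor error is at most `|s - t| / 4`, so the chord projected on the
  -- tangent keeps length at least `|s - t| / 2`. For `|s - t| ≥ h`, simplicity and compactness
  -- bound the chord below.
  set h := 1 / (4 * M) with hh
  have hh0 : 0 < h := by positivity
  set S : Set (ℝ × ℝ) := (Icc 0 l ×ˢ Icc 0 l) ∩ {p | h ≤ |p.1 - p.2|} with hS
  have hScomp : IsCompact S := (isCompact_Icc.prod isCompact_Icc).inter_right
    (isClosed_le continuous_const (by fun_prop))
  have hXc := hΓ.contDiff_X.continuousOn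
  have hYc := hΓ.contDiff_Y.continuousOn
  have m1 : MapsTo Prod.fst S (Icc 0 l) := fun p hp => hp.1.1
  have m2 : MapsTo Prod.snd S (Icc 0 l) := fun p hp => hp.1.2
  have hcont : ContinuousOn (fun p : ℝ × ℝ => (X p.1 - X p.2) ^ 2 + (Y p.1 - Y p.2) ^ 2) S :=
    (((hXc.comp continuousOn_fst m1).sub (hXc.comp continuousOn_snd m2)).pow 2).add
      (((hYc.comp continuousOn_fst m1).sub (hYc.comp continuousOn_snd m2)).pow 2)
  have hpos : ∀ p ∈ S, 0 < (X p.1 - X p.2) ^ 2 + (Y p.1 - Y p.2) ^ 2 := by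
    rintro ⟨s, t⟩ ⟨⟨hs, ht⟩, hst⟩
    have hne : s ≠ t := by
      rintro rfl
      simp only [mem_ofPred_eq, sub_self, abs_zero] at hst
      linarith
    refine lt_of_le_of_ne (by positivity) fun h0 => hne (hΓ.simple hs ht ?_)
    simp only at h0
    have e1 : X s - X t = 0 := by
      nlinarith [sq_nonneg (X s - X t), sq_nonneg (Y s - Y t)]
    have e2 : Y s - Y t = 0 := by
      nlinarith [sq_nonneg (X s - X t), sq_nonneg (Y s - Y t)]
    simp only [Prod.mk.injEq]
    exact ⟨by linarith, by linarith⟩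
  obtain ⟨m, hm, hmin⟩ := hScomp.exists_forall_le' hcont hpos
  have hl := hΓ.l_pos
  refine ⟨min (1 / 4) (m / l ^ 2), by positivity, (min_le_left _ _).trans (by norm_num),
    fun s hs t ht => ?_⟩
  rcases le_total h |s - t| with hst | hst
  · have h1 := hmin (s, t) ⟨⟨hs, ht⟩, hst⟩
    have h2 : (s - t) ^ 2 ≤ l ^ 2 := by
      apply sq_le_sq' <;> linarith [hs.1, hs.2, ht.1, ht.2]
    calc _ ≤ m / l ^ 2 * l ^ 2 := by
          gcongr
          exact min_le_right _ _
      _ = m := by field_simp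
      _ ≤ _ := h1
  · obtain ⟨t1, t2⟩ := hT s hs t ht
    have hn := hΓ.arcLength s hs
    have hx := hΓ.abs_derivWithin_X_le_one hs
    have hy := hΓ.abs_derivWithin_Y_le_one hs
    set x' := derivWithin X (Icc 0 l) s
    set y' := derivWithin Y (Icc 0 l) s
    set E₁ := X s - X t - x' * (s - t) with hE₁
    set E₂ := Y s - Y t - y' * (s - t) with hE₂
    have e1 : |x' * E₁ + y' * E₂| ≤ |s - t| / 2 := by
      have k1 : |x' * E₁| ≤ M * (s - t) ^ 2 := by
        rw [abs_mul]
        exact (mul_le_of_le_one_left (abs_nonneg _) hx).trans t1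
      have k2 : |y' * E₂| ≤ M * (s - t) ^ 2 := by
        rw [abs_mul]
        exact (mul_le_of_le_one_left (abs_nonneg _) hy).trans t2
      have k3 : M * (s - t) ^ 2 ≤ |s - t| / 4 := by
        rw [← sq_abs]
        calc M * |s - t| ^ 2 = M * |s - t| * |s - t| := by ring
          _ ≤ M * h * |s - t| := by gcongr
          _ = _ := by rw [hh]; field_simp
      linarith [abs_add_le (x' * E₁) (y' * E₂)]
    have e2 : x' * (X s - X t) + y' * (Y s - Y t) = (s - t) + (x' * E₁ + y' * E₂) := by
      rw [hE₁, hE₂]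
      linear_combination (s - t) * hn
    have e3 : |s - t| / 2 ≤ |x' * (X s - X t) + y' * (Y s - Y t)| := by
      rw [e2]
      have := abs_sub_abs_le_abs_sub (s - t) (-(x' * E₁ + y' * E₂))
      rw [abs_neg, sub_neg_eq_add] at this
      linarith
    have e4 : (x' * (X s - X t) + y' * (Y s - Y t)) ^ 2 ≤ (X s - X t) ^ 2 + (Y s - Y t) ^ 2 := by
      have : (X s - X t) ^ 2 + (Y s - Y t) ^ 2 = (x' * (X s - X t) + y' * (Y s - Y t)) ^ 2 +
          (x' * (Y s - Y t) - y' * (X s - X t)) ^ 2 := by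
        linear_combination -((X s - X t) ^ 2 + (Y s - Y t) ^ 2) * hn
      rw [this]
      exact le_add_of_nonneg_right (sq_nonneg _)
    have e5 : (|s - t| / 2) ^ 2 ≤ (x' * (X s - X t) + y' * (Y s - Y t)) ^ 2 := by
      rw [← sq_abs (x' * (X s - X t) + y' * (Y s - Y t))]
      gcongr
    rw [div_pow, sq_abs] at e5
    have e6 := mul_le_mul_of_nonneg_right (min_le_left (1 / 4) (m / l ^ 2)) (sq_nonneg (s - t))
    linarith

/-- Bounds of the distance to an arbitrary point of the plane and of the numerator of the
double layer kernel, in terms of the distance `d` of that point from the curve and the parameter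
`t₀` of a nearest point. -/
theorem exists_nearest (hΓ : IsBoundaryCurve a b l X Y) :
    ∃ κ M : ℝ, 0 < κ ∧ κ ≤ 1 ∧ 0 ≤ M ∧ ∀ x₀ y₀ : ℝ, ∃ t₀ ∈ Icc 0 l, ∃ d : ℝ, 0 ≤ d ∧
      ∀ s ∈ Icc 0 l, κ * (s - t₀) ^ 2 ≤ (X s - x₀) ^ 2 + (Y s - y₀) ^ 2 ∧
        d ^ 2 ≤ (X s - x₀) ^ 2 + (Y s - y₀) ^ 2 ∧
        |derivWithin Y (Icc 0 l) s * (X s - x₀) - derivWithin X (Icc 0 l) s * (Y s - y₀)| ≤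
          d + M * (s - t₀) ^ 2 := by
  obtain ⟨M, hM, hT⟩ := hΓ.exists_taylor
  obtain ⟨c, hc, hc1, hca⟩ := hΓ.exists_chord_arc
  refine ⟨c / 4, 2 * M, by positivity, by linarith, by positivity, fun x₀ y₀ => ?_⟩
  have hcont : ContinuousOn (fun s => (X s - x₀) ^ 2 + (Y s - y₀) ^ 2) (Icc 0 l) :=
    ((hΓ.contDiff_X.continuousOn.sub continuousOn_const).pow 2).add
      ((hΓ.contDiff_Y.continuousOn.sub continuousOn_const).pow 2)
  obtain ⟨t₀, ht₀, hmin⟩ := isCompact_Icc.exists_isMinOn ⟨0, le_rfl, hΓ.l_pos.le⟩ hcont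
  rw [isMinOn_iff] at hmin
  have hd2 := Real.sq_sqrt (by positivity : 0 ≤ (X t₀ - x₀) ^ 2 + (Y t₀ - y₀) ^ 2)
  refine ⟨t₀, ht₀, Real.sqrt ((X t₀ - x₀) ^ 2 + (Y t₀ - y₀) ^ 2), Real.sqrt_nonneg _,
    fun s hs => ⟨?_, by rw [hd2]; exact hmin s hs, ?_⟩⟩
  · have h1 := hmin s hs
    have h2 := hca s hs t₀ ht₀
    -- The nearest point is no farther from the pole than the point at `s`, so the chord is at most
    -- twice the distance at `s`. Squaring gives the `4` in `κ = c / 4`.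
    nlinarith [sq_nonneg (X s - x₀ + (X t₀ - x₀)), sq_nonneg (Y s - y₀ + (Y t₀ - y₀))]
  · obtain ⟨t1, t2⟩ := hT s hs t₀ ht₀
    have hn := hΓ.arcLength s hs
    have hx := hΓ.abs_derivWithin_X_le_one hs
    have hy := hΓ.abs_derivWithin_Y_le_one hs
    set x' := derivWithin X (Icc 0 l) s
    set y' := derivWithin Y (Icc 0 l) s
    set E₁ := X s - X t₀ - x' * (s - t₀) with hE₁
    set E₂ := Y s - Y t₀ - y' * (s - t₀) with hE₂
    -- The tangential Taylor term drops out against the normal at `s`. The nearest point contributes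
    -- at most `d`, the normal being a unit vector, and the two Taylor errors give `2 * M`.
    have e0 : y' * (X s - x₀) - x' * (Y s - y₀) =
        (y' * (X t₀ - x₀) - x' * (Y t₀ - y₀)) + y' * E₁ - x' * E₂ := by
      rw [hE₁, hE₂]; ring
    have k1 : |y' * E₁| ≤ M * (s - t₀) ^ 2 := by
      rw [abs_mul]
      exact (mul_le_of_le_one_left (abs_nonneg _) hy).trans t1
    have k2 : |x' * E₂| ≤ M * (s - t₀) ^ 2 := by
      rw [abs_mul]
      exact (mul_le_of_le_one_left (abs_nonneg _) hx).trans t2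
    have k3 : |y' * (X t₀ - x₀) - x' * (Y t₀ - y₀)| ≤
        Real.sqrt ((X t₀ - x₀) ^ 2 + (Y t₀ - y₀) ^ 2) := by
      refine Real.abs_le_sqrt ?_
      have : (X t₀ - x₀) ^ 2 + (Y t₀ - y₀) ^ 2 = (y' * (X t₀ - x₀) - x' * (Y t₀ - y₀)) ^ 2 +
          (x' * (X t₀ - x₀) + y' * (Y t₀ - y₀)) ^ 2 := by
        linear_combination -((X t₀ - x₀) ^ 2 + (Y t₀ - y₀) ^ 2) * hn
      rw [this]
      exact le_add_of_nonneg_right (sq_nonneg _)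
    rw [e0]
    have := abs_sub (y' * (X t₀ - x₀) - x' * (Y t₀ - y₀) + y' * E₁) (x' * E₂)
    have := abs_add_le (y' * (X t₀ - x₀) - x' * (Y t₀ - y₀)) (y' * E₁)
    linarith

end IsBoundaryCurve

/-! ### Endpoint condition and integrable majorants on `[0, l]` -/

/-- If `f` is positive inside `[0, l]` and `|g| ≤ c * f ^ (1 + ε)` near the endpoints, then the
bounded function `|g|` is dominated by a multiple of `f`. -/
theorem exists_abs_le_mul {l δ c ε : ℝ} {f g : ℝ → ℝ} (hε : 0 < ε) (hδ : 0 < δ)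
    (hf : ContinuousOn f (Icc 0 l)) (hpos : ∀ s ∈ Ioo 0 l, 0 < f s)
    (hg : ∀ s ∈ Icc 0 l, |g s| ≤ 1)
    (h : ∀ s ∈ Icc 0 l, (s ≤ δ ∨ l - δ ≤ s) → |g s| ≤ c * f s ^ (1 + ε)) :
    ∃ K : ℝ, 0 ≤ K ∧ ∀ s ∈ Ioo 0 l, |g s| ≤ K * f s := by
  obtain ⟨B, hB⟩ := isCompact_Icc.exists_bound_of_continuousOn hf
  have hsub : Icc δ (l - δ) ⊆ Ioo 0 l := fun s hs => ⟨by linarith [hs.1], by linarith [hs.2]⟩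
  -- The middle interval may be empty; a positive `m` exists all the same.
  obtain ⟨m, hm, hmin⟩ := isCompact_Icc.exists_forall_le'
    (hf.mono (hsub.trans Ioo_subset_Icc_self)) fun s hs => hpos s (hsub hs)
  refine ⟨|c| * |B| ^ ε + 1 / m, by positivity, fun s hs => ?_⟩
  have hs' := Ioo_subset_Icc_self hs
  have hfs := hpos s hs
  by_cases hcase : s ≤ δ ∨ l - δ ≤ s
  · have hfB : f s ≤ |B| := (le_abs_self _).trans ((hB s hs').trans (le_abs_self _))
    calc |g s| ≤ c * f s ^ (1 + ε) := h s hs' hcase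
      _ ≤ |c| * f s ^ (1 + ε) := by gcongr; exact le_abs_self c
      _ = |c| * f s ^ ε * f s := by rw [add_comm, Real.rpow_add_one hfs.ne']; ring
      _ ≤ |c| * |B| ^ ε * f s := by gcongr
      _ ≤ _ := by
        have : 0 ≤ 1 / m * f s := by positivity
        rw [add_mul]; linarith
  · push Not at hcase
    have h1 := hmin s ⟨hcase.1.le, hcase.2.le⟩
    calc |g s| ≤ 1 := hg s hs'
      _ ≤ 1 / m * f s := by rw [one_div, inv_mul_eq_div, one_le_div hm]; exact h1
      _ ≤ _ := by
        have : 0 ≤ |c| * |B| ^ ε * f s := by positivity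
        rw [add_mul]; linarith

theorem intervalIntegrable_abs_rpow {r : ℝ} (hr : -1 < r) (p q : ℝ) :
    IntervalIntegrable (fun t : ℝ => |t| ^ r) volume p q := by
  have key : ∀ c : ℝ, 0 ≤ c → IntervalIntegrable (fun t : ℝ => |t| ^ r) volume 0 c := by
    intro c hc
    refine (intervalIntegral.intervalIntegrable_rpow' hr).congr fun t ht => ?_
    rw [uIoc_of_le hc] at ht
    simp only [abs_of_pos ht.1]
  have all : ∀ c : ℝ, IntervalIntegrable (fun t : ℝ => |t| ^ r) volume 0 c := by
    intro c
    rcases le_total 0 c with hc | hc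
    · exact key c hc
    · rw [IntervalIntegrable.iff_comp_neg]
      simpa using key (-c) (by linarith)
  exact (all p).symm.trans (all q)

/-- Translation moves `[0, l]` into `[-l, l]` whatever `t₀` is, so the bound does not depend on the
pole. -/
theorem integral_abs_sub_rpow_le {r l t₀ : ℝ} (hr : -1 < r) (ht₀ : t₀ ∈ Icc 0 l) :
    IntervalIntegrable (fun s : ℝ => |s - t₀| ^ r) volume 0 l ∧
    ∫ s in (0 : ℝ)..l, |s - t₀| ^ r ≤ ∫ t in (-l)..l, |t| ^ r := by
  constructor
  · have h := (intervalIntegrable_abs_rpow hr (0 - t₀) (l - t₀)).comp_sub_right t₀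
    simpa using h
  · rw [intervalIntegral.integral_comp_sub_right (fun t => |t| ^ r) t₀]
    exact intervalIntegral.integral_mono_interval (by linarith [ht₀.2]) (by linarith [ht₀.1, ht₀.2])
      (by linarith [ht₀.1]) (Filter.Eventually.of_forall fun t => Real.rpow_nonneg (abs_nonneg t) r)
      (intervalIntegrable_abs_rpow hr _ _)

/-- A primitive is `arctan ((s - t₀) / d)`, whose total variation is at most `π` for every `d`. This
gives uniformity as the pole approaches the curve; at `d = 0` the integrand vanishes. -/
theorem integral_div_sq_add_sq_le {d : ℝ} (hd : 0 ≤ d) (l t₀ : ℝ) :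
    IntervalIntegrable (fun s : ℝ => d / (d ^ 2 + (s - t₀) ^ 2)) volume 0 l ∧
    ∫ s in (0 : ℝ)..l, d / (d ^ 2 + (s - t₀) ^ 2) ≤ Real.pi := by
  rcases hd.eq_or_lt with rfl | hd
  · simp [Real.pi_pos.le]
  have hi : IntervalIntegrable (fun s : ℝ => d / (d ^ 2 + (s - t₀) ^ 2)) volume 0 l := by
    refine Continuous.intervalIntegrable ?_ _ _
    exact continuous_const.div (by fun_prop) fun s => by positivity
  refine ⟨hi, ?_⟩
  have hderiv : ∀ s ∈ uIcc 0 l, HasDerivAt (fun s => Real.arctan ((s - t₀) / d))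
      (d / (d ^ 2 + (s - t₀) ^ 2)) s := by
    intro s _
    refine (((hasDerivAt_id s).sub_const t₀).div_const d).arctan.congr_deriv ?_
    simp only [id]
    field_simp
  rw [intervalIntegral.integral_eq_sub_of_hasDerivAt hderiv hi]
  have h1 := Real.arctan_lt_pi_div_two ((l - t₀) / d)
  have h2 := Real.neg_pi_div_two_lt_arctan ((0 - t₀) / d)
  linarith

/-! ### Measurability and the final estimate -/

/-- Joint measurability in point and direction lets the normal derivative be composed with the curve
without any continuity statement at the pole or on the axes. -/
theorem measurable_kernelDeriv (α β x₀ y₀ : ℝ) :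
    Measurable fun z : (ℝ × ℝ) × ℝ × ℝ => kernelDeriv α β z.1.1 z.1.2 x₀ y₀ z.2.1 z.2.2 := by
  unfold kernelDeriv
  refine Measurable.const_mul (StronglyMeasurable.measurable
    (StronglyMeasurable.integral_prod_right ?_)) _
  refine Measurable.stronglyMeasurable ?_
  unfold Function.uncurry
  fun_prop

theorem aemeasurable_rpow_mul_abs_kernelDeriv {l : ℝ} {X Y A B : ℝ → ℝ} (hl : 0 ≤ l)
    (hX : ContinuousOn X (Icc 0 l)) (hY : ContinuousOn Y (Icc 0 l)) (hA : ContinuousOn A (Icc 0 l))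
    (hB : ContinuousOn B (Icc 0 l)) (α β x₀ y₀ p q : ℝ) :
    AEMeasurable (fun s => X s ^ p * Y s ^ q *
      |kernelDeriv α β (X s) (Y s) x₀ y₀ (A s) (B s)|) (volume.restrict (uIoc 0 l)) := by
  have m : ∀ {f : ℝ → ℝ}, ContinuousOn f (Icc 0 l) →
      AEMeasurable f (volume.restrict (uIoc 0 l)) := fun hf => by
    rw [uIoc_of_le hl]
    exact (hf.mono Ioc_subset_Icc_self).aemeasurable measurableSet_Ioc
  have hF : Measurable fun z : (ℝ × ℝ) × ℝ × ℝ =>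
      z.1.1 ^ p * z.1.2 ^ q * ‖kernelDeriv α β z.1.1 z.1.2 x₀ y₀ z.2.1 z.2.2‖ :=
    Measurable.mul (by fun_prop) (measurable_kernelDeriv α β x₀ y₀).norm
  exact hF.comp_aemeasurable (((m hX).prodMk (m hY)).prodMk ((m hA).prodMk (m hB)))

theorem theorem3p2 (α β : ℝ) (hα₀ : 0 < 2 * α) (hα₁ : 2 * α < 1) (hβ₀ : 0 < 2 * β)
    (hβ₁ : 2 * β < 1) (a b l : ℝ) (X Y : ℝ → ℝ) (hΓ : IsBoundaryCurve a b l X Y)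
    (hend : EndpointCondition l X Y) :
    ∃ C₁ : ℝ, ∀ x₀ y₀ : ℝ, 0 ≤ x₀ → 0 ≤ y₀ →
      IntervalIntegrable
        (fun s => X s ^ (2 * α) * Y s ^ (2 * β) *
          |normalDeriv l X Y (fun x y => q₁ α β x y x₀ y₀) s|) volume 0 l ∧
      ∫ s in (0 : ℝ)..l, X s ^ (2 * α) * Y s ^ (2 * β) *
          |normalDeriv l X Y (fun x y => q₁ α β x y x₀ y₀) s| ≤ C₁ := by
  have hα : 0 < α := by linarith
  have hβ : 0 < β := by linarith
  have hl := hΓ.l_pos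
  obtain ⟨c, ε, δ, hε, -, hδ, hend⟩ := hend
  have hXc := hΓ.contDiff_X.continuousOn
  have hYc := hΓ.contDiff_Y.continuousOn
  have hX'c := hΓ.contDiff_X.continuousOn_derivWithin (uniqueDiffOn_Icc hl) (by norm_num)
  have hY'c := hΓ.contDiff_Y.continuousOn_derivWithin (uniqueDiffOn_Icc hl) (by norm_num)
  obtain ⟨K₁, hK₁, hX'⟩ := exists_abs_le_mul hε hδ hYc (fun s hs => (hΓ.pos s hs).2)
    (fun s hs => hΓ.abs_derivWithin_X_le_one hs) fun s hs h => (hend s hs h).1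
  obtain ⟨K₂, hK₂, hY'⟩ := exists_abs_le_mul hε hδ hXc (fun s hs => (hΓ.pos s hs).1)
    (fun s hs => hΓ.abs_derivWithin_Y_le_one hs) fun s hs h => (hend s hs h).2
  obtain ⟨B₁, hB₁⟩ := isCompact_Icc.exists_bound_of_continuousOn hXc
  obtain ⟨B₂, hB₂⟩ := isCompact_Icc.exists_bound_of_continuousOn hYc
  obtain ⟨κ, M, hκ, hκ1, hM, hnear⟩ := hΓ.exists_nearest
  obtain ⟨C, D, hC, hD, hCD⟩ := exists_rpow_mul_abs_kernelDeriv_le hα (by linarith) hβ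
    (by linarith)
  have hr : -1 < -(α + β) := by linarith
  set E := D * ((K₂ + K₁) * (|B₁| ^ α * |B₂| ^ β * κ ^ (-((α + β) / 2)))) with hE
  have hE0 : 0 ≤ E := by positivity
  -- The three terms come from the arctangent kernel, the weak singularity `|s - t₀| ^ (-(α + β))`
  -- and the bounded Taylor remainder. All constants are fixed before the pole is chosen.
  refine ⟨C * (2 / κ) * Real.pi + E * (∫ t in (-l)..l, |t| ^ (-(α + β))) + C * (M / κ) * l,
    fun x₀ y₀ hx₀ hy₀ => ?_⟩
  obtain ⟨t₀, ht₀, d, hd, hs₀⟩ := hnear x₀ y₀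
  obtain ⟨i1, b1⟩ := integral_div_sq_add_sq_le hd l t₀
  obtain ⟨i2, b2⟩ := integral_abs_sub_rpow_le hr ht₀
  set G : ℝ → ℝ := fun s => C * (2 / κ) * (d / (d ^ 2 + (s - t₀) ^ 2)) +
    E * |s - t₀| ^ (-(α + β)) + C * (M / κ) with hG
  have hGi : IntervalIntegrable G volume 0 l :=
    ((i1.const_mul _).add (i2.const_mul _)).add intervalIntegrable_const
  set N : ℝ → ℝ := fun s => kernelDeriv α β (X s) (Y s) x₀ y₀ (derivWithin Y (Icc 0 l) s)
    (-derivWithin X (Icc 0 l) s) with hN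
  -- The curve can meet the pole only at `s = t₀`, a null set; every pointwise estimate leaves it
  -- out.
  have hrpos : ∀ s ∈ Icc 0 l, s ≠ t₀ → 0 < (X s - x₀) ^ 2 + (Y s - y₀) ^ 2 := by
    intro s hs hne
    have : 0 < (s - t₀) ^ 2 := by
      have := sub_ne_zero.2 hne
      positivity
    exact (mul_pos hκ this).trans_le (hs₀ s hs).1
  have heq : ∀ s ∈ Ioo 0 l, s ≠ t₀ →
      normalDeriv l X Y (fun x y => q₁ α β x y x₀ y₀) s = N s := by
    intro s hs hne
    obtain ⟨hx, hy⟩ := hΓ.pos s hs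
    simp only [hN]
    rw [kernelDeriv_eq hα hβ hx hy hx₀ hy₀ (hrpos s (Ioo_subset_Icc_self hs) hne), normalDeriv]
    ring
  have hle : ∀ s ∈ Ioo 0 l, s ≠ t₀ → X s ^ (2 * α) * Y s ^ (2 * β) * |N s| ≤ G s := by
    intro s hs hne
    have hs' := Ioo_subset_Icc_self hs
    obtain ⟨hx, hy⟩ := hΓ.pos s hs
    have hr0 := hrpos s hs' hne
    obtain ⟨n1, n2, n3⟩ := hs₀ s hs'
    refine (hCD _ _ _ _ _ _ hx hy hx₀ hy₀ hr0).trans ?_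
    have hst : 0 < (s - t₀) ^ 2 := by
      have := sub_ne_zero.2 hne
      positivity
    rw [abs_neg, neg_mul, ← sub_eq_add_neg]
    set r := (X s - x₀) ^ 2 + (Y s - y₀) ^ 2 with hrdef
    have p1 : |derivWithin Y (Icc 0 l) s * (X s - x₀) - derivWithin X (Icc 0 l) s * (Y s - y₀)| / r
        ≤ 2 / κ * (d / (d ^ 2 + (s - t₀) ^ 2)) + M / κ := by
      have q1 : d / r ≤ 2 / κ * (d / (d ^ 2 + (s - t₀) ^ 2)) := by
        rw [div_mul_div_comm, div_le_div_iff₀ hr0 (by positivity)]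
        -- Sum of the two lower bounds for `r`, with `κ ≤ 1` used on the `d²` term.
        have : κ * (d ^ 2 + (s - t₀) ^ 2) ≤ 2 * r := by nlinarith [sq_nonneg d]
        nlinarith
      have q2 : M * (s - t₀) ^ 2 / r ≤ M / κ := by
        rw [div_le_div_iff₀ hr0 hκ]
        nlinarith
      calc _ ≤ (d + M * (s - t₀) ^ 2) / r := by gcongr
        _ = d / r + M * (s - t₀) ^ 2 / r := add_div _ _ _
        _ ≤ _ := add_le_add q1 q2
    have p2 : |derivWithin Y (Icc 0 l) s| / X s ≤ K₂ := (div_le_iff₀ hx).2 (hY' s hs)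
    have p3 : |derivWithin X (Icc 0 l) s| / Y s ≤ K₁ := (div_le_iff₀ hy).2 (hX' s hs)
    have p4 : r ^ (-((α + β) / 2)) ≤ κ ^ (-((α + β) / 2)) * |s - t₀| ^ (-(α + β)) := by
      refine (Real.rpow_le_rpow_of_nonpos (mul_pos hκ hst) n1 (by linarith)).trans_eq ?_
      rw [Real.mul_rpow hκ.le hst.le, ← sq_abs, ← Real.rpow_two, ← Real.rpow_mul (abs_nonneg _)]
      ring_nf
    have p5 : X s ≤ |B₁| := (le_abs_self _).trans ((hB₁ s hs').trans (le_abs_self _))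
    have p6 : Y s ≤ |B₂| := (le_abs_self _).trans ((hB₂ s hs').trans (le_abs_self _))
    have hrp := Real.rpow_nonneg hr0.le (-((α + β) / 2))
    calc _ ≤ C * (2 / κ * (d / (d ^ 2 + (s - t₀) ^ 2)) + M / κ) +
          D * ((K₂ + K₁) * (|B₁| ^ α * |B₂| ^ β *
            (κ ^ (-((α + β) / 2)) * |s - t₀| ^ (-(α + β))))) := by gcongr
      _ = G s := by simp only [hG, hE]; ring
  have hae : ∀ᵐ s ∂(volume.restrict (uIoc 0 l)), s ∈ Ioo 0 l ∧ s ≠ t₀ := by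
    rw [uIoc_of_le hl.le, ← restrict_Ioo_eq_restrict_Ioc]
    exact (ae_restrict_mem measurableSet_Ioo).and (Measure.ae_ne _ t₀)
  have hmeas : AEStronglyMeasurable (fun s => X s ^ (2 * α) * Y s ^ (2 * β) *
      |normalDeriv l X Y (fun x y => q₁ α β x y x₀ y₀) s|) (volume.restrict (uIoc 0 l)) := by
    have mF := aemeasurable_rpow_mul_abs_kernelDeriv hl.le hXc hYc hY'c hX'c.neg α β x₀ y₀
      (2 * α) (2 * β)
    refine mF.aestronglyMeasurable.congr ?_
    filter_upwards [hae] with s hs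
    simp only [heq s hs.1 hs.2, hN, Pi.neg_apply]
  have hbound : ∀ s ∈ Ioo 0 l, s ≠ t₀ → X s ^ (2 * α) * Y s ^ (2 * β) *
      |normalDeriv l X Y (fun x y => q₁ α β x y x₀ y₀) s| ≤ G s := fun s hs hne => by
    rw [heq s hs hne]
    exact hle s hs hne
  have hint := hGi.mono_fun' hmeas (by
    filter_upwards [hae] with s hs
    obtain ⟨hx, hy⟩ := hΓ.pos s hs.1
    rw [Real.norm_of_nonneg (by positivity)]
    exact hbound s hs.1 hs.2)
  refine ⟨hint, ?_⟩
  calc _ ≤ ∫ s in (0 : ℝ)..l, G s := by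
        refine intervalIntegral.integral_mono_ae_restrict hl.le hint hGi ?_
        rw [← restrict_Ioo_eq_restrict_Icc]
        filter_upwards [ae_restrict_mem measurableSet_Ioo, Measure.ae_ne _ t₀] with s hs hne
        exact hbound s hs hne
    _ = C * (2 / κ) * (∫ s in (0 : ℝ)..l, d / (d ^ 2 + (s - t₀) ^ 2)) +
        E * (∫ s in (0 : ℝ)..l, |s - t₀| ^ (-(α + β))) + C * (M / κ) * l := by
        simp only [hG]
        rw [intervalIntegral.integral_add ((i1.const_mul _).add (i2.const_mul _))
          intervalIntegrable_const, intervalIntegral.integral_add (i1.const_mul _) (i2.const_mul _),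
          intervalIntegral.integral_const_mul, intervalIntegral.integral_const_mul,
          intervalIntegral.integral_const, smul_eq_mul]
        ring
    _ ≤ _ := by gcongr
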